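/- Let $\Omega\subset\mathbb{R}^2$ be a bounded, connected, simply connected domain whose boundary is a simple closed piecewise smooth curve (continuous, and consisting of finitely many arcs that are $C^1$ up to their end points). Let $L=|\partial\Omega|$ be its perimeter, fix a reference point on $\partial\Omega$, and parametrize $\partial\Omega$ by the arclength $s\in[0,L)$ in the positive direction ($\Omega$ on the left). Let $\Phi=\{(s,\theta): 0\le s<L,\ 0\le\theta\le\pi\}$ be the phase space of the billiard map, where $\theta$ is the angle from the positive tangent at the boundary point $s$ to the outgoing velocity, and let $\nu$ be the Liouville measure, $d\nu=\sin\theta\,ds\,d\theta$. The billiard map $\varphi$ sends $(s,\theta)$ to $(s',\theta')$, where $s'$ is the first boundary point that is hit by a ball leaving $s$ in the direction $\theta$ and $\theta'$ gives its direction after the elastic reflection there; it is defined if $s$ and $s'$ are not corners and the velocities there are not tangent to $\partial\Omega$. For $z=(s,\theta)$ with $\varphi(z)=(s',\theta')$ let $\xi(z)\in[0,L)$ be the number with $s+\xi(z)=s'$ or $s+\xi(z)=s'+L$. The rotation number of $z$ is $$\rho(z)=\frac1L\lim_{n\to\infty}\frac1n\sum_{k=0}^{n-1}\xi(\varphi^k(z)),$$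 defined if the whole forward orbit of $z$ is defined and the limit exists. Then $\rho(z)$ exists for $\nu$-almost every $z\in\Phi$, and: 1. For every Borel set $X\subset[0,1]$, with $1-X=\{1-x: x\in X\}$, the sets $\rho^{-1}(X)$ and $\rho^{-1}(1-X)$ are measurable subsets of $\Phi$, and $\nu(\rho^{-1}(X))=\nu(\rho^{-1}(1-X))$. 2. $\rho$ is $\nu$-integrable and $$\frac{\int_\Phi\rho\,d\nu}{\nu(\Phi)}=\frac12 .$$ 3. If the billiard in $\Omega$ is ergodic, i.e. every $\varphi$-invariant measurable set is $\nu$-null or has $\nu$-null complement, then $\rho(z)=\frac12$ for $\nu$-almost every $z\in\Phi$. -/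

import Mathlib

noncomputable section

namespace PlanarBilliard

open Set Filter Topology MeasureTheory

/-- `γ` is a positively oriented arclength parametrization, of total length `L`, of the boundary
of the plane domain `Ω`, and this boundary is a simple closed piecewise smooth curve.
The curve is written as an `L`-periodic function on the line, i.e. as a function on `ℝ / Lℤ`.
Outside finitely many vertices the curve is `C¹`, and each arc between vertices is `C¹` up to and
including its end points; the vertices may be corners of any angle, including cusps. -/
structure IsBoundaryParam (Ω : Set ℂ) (L : ℝ) (γ : ℝ → ℂ) : Prop where
  perimeter_pos : 0 < L
  periodic : Function.Periodic γ L
  continuous : Continuous γ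
  /-- the closed curve is simple -/
  injOn : InjOn γ (Ico 0 L)
  range_eq : range γ = frontier Ω
  piecewise_smooth : ∃ vertices : Set ℂ, vertices.Finite ∧
    ∀ a b : ℝ, a < b → (∀ s ∈ Ioo a b, γ s ∉ vertices) → ContDiffOn ℝ 1 γ (Icc a b)
  /-- `s` is the arclength -/
  unit_speed : ∀ s, ContDiffAt ℝ 1 γ s → ‖deriv γ s‖ = 1
  /-- positive orientation: at every smooth boundary point the domain lies on the left of the
  curve, and not on its right -/
  positively_oriented : ∀ s, ContDiffAt ℝ 1 γ s → ∀ᶠ ε : ℝ in 𝓝[>] 0,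
    γ s + ε * (Complex.I * deriv γ s) ∈ Ω ∧ γ s - ε * (Complex.I * deriv γ s) ∉ Ω

/-- The phase space `Φ` of the billiard map in the standard coordinates `(s, θ)`: `s` is the
arclength coordinate of the footpoint, `θ` the angle from the positive tangent to the outgoing
velocity. -/
def phaseSpace (L : ℝ) : Set (ℝ × ℝ) := Ico 0 L ×ˢ Icc 0 Real.pi

/-- The Liouville measure `dν = sin θ ds dθ` on the phase space. -/
def liouville (L : ℝ) : Measure (ℝ × ℝ) :=
  (volume.restrict (phaseSpace L)).withDensity fun z => ENNReal.ofReal (Real.sin z.2)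

/-- Phase points with a smooth footpoint and a velocity that is not tangent to the boundary. -/
def smoothPhase (L : ℝ) (γ : ℝ → ℂ) : Set (ℝ × ℝ) :=
  {z | z.1 ∈ Ico 0 L ∧ ContDiffAt ℝ 1 γ z.1 ∧ z.2 ∈ Ioo 0 Real.pi}

/-- The outgoing unit velocity at the phase point `(s, θ)`. -/
def outVelocity (γ : ℝ → ℂ) (z : ℝ × ℝ) : ℂ :=
  deriv γ z.1 * Complex.exp (z.2 * Complex.I)

/-- The unit velocity with which a ball arrives at the footpoint of `(s, θ)` if its velocity
after the elastic reflection there is the outgoing velocity of `(s, θ)`: the mirror image of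
the latter in the tangent line. -/
def inVelocity (γ : ℝ → ℂ) (z : ℝ × ℝ) : ℂ :=
  deriv γ z.1 * Complex.exp (-(z.2 * Complex.I))

/-- One step of the billiard: the ball leaves the footpoint of `z` with the outgoing velocity
of `z`, moves freely inside `Ω` until it hits the boundary for the first time, at the footpoint of
`w`, and is reflected there by the law that the angle of incidence equals the angle of
reflection. For given `z` there is at most one such `w`; there is none if the ball runs into a
vertex or hits the boundary tangentially. -/
def Step (Ω : Set ℂ) (L : ℝ) (γ : ℝ → ℂ) (z w : ℝ × ℝ) : Prop :=
  z ∈ smoothPhase L γ ∧ w ∈ smoothPhase L γ ∧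
    (∃ t : ℝ, 0 < t ∧ γ w.1 = γ z.1 + t * outVelocity γ z ∧
      ∀ u ∈ Ioo 0 t, γ z.1 + u * outVelocity γ z ∈ Ω) ∧
    outVelocity γ z = inVelocity γ w

/-- The phase points at which the billiard map is defined. -/
def mapDomain (Ω : Set ℂ) (L : ℝ) (γ : ℝ → ℂ) : Set (ℝ × ℝ) :=
  {z | ∃ w, Step Ω L γ z w}

open Classical in
/-- The billiard map `φ`, extended by the identity to the (null) set of phase points at which it
is not defined. -/
def billiardMap (Ω : Set ℂ) (L : ℝ) (γ : ℝ → ℂ) (z : ℝ × ℝ) : ℝ × ℝ :=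
  if h : ∃ w, Step Ω L γ z w then h.choose else z

/-- For arclength coordinates `s₁, s₂ ∈ [0, L)`, the unique `ξ ∈ [0, L)` with `s₁ + ξ = s₂` or
`s₁ + ξ = s₂ + L`. -/
def increment (L s₁ s₂ : ℝ) : ℝ := if s₁ ≤ s₂ then s₂ - s₁ else s₂ + L - s₁

/-- The footpoint increment function `ξ(z)`. -/
def footpointIncrement (Ω : Set ℂ) (L : ℝ) (γ : ℝ → ℂ) (z : ℝ × ℝ) : ℝ :=
  increment L z.1 (billiardMap Ω L γ z).1

/-- The average of the footpoint increments over the first `n` steps of the orbit of `z`. -/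
def averageIncrement (Ω : Set ℂ) (L : ℝ) (γ : ℝ → ℂ) (z : ℝ × ℝ) (n : ℕ) : ℝ :=
  (∑ k ∈ Finset.range n, footpointIncrement Ω L γ ((billiardMap Ω L γ)^[k] z)) / n

/-- The set of phase points whose whole forward orbit is defined and for which the limit that
defines the footpoint gain (equivalently, the rotation number) exists. -/
def rotationDomain (Ω : Set ℂ) (L : ℝ) (γ : ℝ → ℂ) : Set (ℝ × ℝ) :=
  {z | (∀ k : ℕ, (billiardMap Ω L γ)^[k] z ∈ mapDomain Ω L γ) ∧
    ∃ υ : ℝ, Tendsto (averageIncrement Ω L γ z) atTop (𝓝 υ)}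

/-- The footpoint gain `υ(z)`; meaningful for `z ∈ rotationDomain Ω L γ`. -/
def footpointGain (Ω : Set ℂ) (L : ℝ) (γ : ℝ → ℂ) (z : ℝ × ℝ) : ℝ :=
  limUnder atTop (averageIncrement Ω L γ z)

/-- The rotation number `ρ(z) = υ(z) / |∂Ω|`; meaningful for `z ∈ rotationDomain Ω L γ`. -/
def rotationNumber (Ω : Set ℂ) (L : ℝ) (γ : ℝ → ℂ) (z : ℝ × ℝ) : ℝ :=
  footpointGain Ω L γ z / L

/-- The preimage `ρ⁻¹(X)`: the phase points that have a rotation number, lying in `X`. -/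
def rotationPreimage (Ω : Set ℂ) (L : ℝ) (γ : ℝ → ℂ) (X : Set ℝ) : Set (ℝ × ℝ) :=
  {z | z ∈ rotationDomain Ω L γ ∧ rotationNumber Ω L γ z ∈ X}

/-- The billiard in `Ω` is ergodic: every Borel set of phase points that is invariant under the
billiard map is `ν`-null or has a `ν`-null complement. (That the billiard map preserves `ν` is not
part of this condition.) -/
def IsErgodicBilliard (Ω : Set ℂ) (L : ℝ) (γ : ℝ → ℂ) : Prop :=
  PreErgodic (billiardMap Ω L γ) (liouville L)

end PlanarBilliard

end

/-! Running a billiard orbit backwards replaces each increment ξ by L - ξ, since the reversed ball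
gains the complementary boundary arc. Let R(s, θ) = (s, π - θ) be time reversal and A_n the average
of the first n increments. Then A_n ∘ (R ∘ φⁿ) = L - A_n for n ≥ 1, wherever the forward orbit is
defined (`averageIncrement_reversal_iterate`). Both R and φ preserve ν, so A_n and L - A_n have the
same law. By Birkhoff's theorem A_n converges almost everywhere, the equality of laws passes to the
limit (`map_footpointGain`), and ρ and 1 - ρ have the same law. Integration gives the mean 1/2. In
the ergodic case the invariant sets {ρ < 1/2} and {ρ > 1/2} are disjoint and of equal measure, so
neither can be conull and both are null.

Most of the work goes into showing that φ is measurable, defined almost everywhere, and preserves ν.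
The graph of φ is Borel and projects injectively to its first factor, which gives measurability. For
the rest, ν is disintegrated over the outgoing velocity v (`liouville_apply_eq_lintegral_flux`). For
fixed v, the density sin θ ds is length measured across the lines parallel to v. Free flight does
not change the line, so a collision followed by reversal carries the slice of v to the slice of -v
without changing its flux (`flux_image`). The lines of direction v that meet a vertex or touch the
boundary tangentially form a null set, by finiteness of the vertices and a one-dimensional Sard
argument (`flux_compl_mapDomain`). -/

namespace PlanarBilliard

open Set Filter Topology MeasureTheory ComplexConjugate

/-! ### Birkhoff's ergodic theorem for bounded functions -/

section Birkhoff

variable {X : Type*} {T : X → X} {g : X → ℝ}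

/-- The running maximum of the Birkhoff sums of `g` of length at most `n`, the empty sum
included. -/
def maxBirkhoffSum (T : X → X) (g : X → ℝ) : ℕ → X → ℝ
  | 0, _ => 0
  | n + 1, x => max 0 (g x + maxBirkhoffSum T g n (T x))

theorem maxBirkhoffSum_nonneg (n : ℕ) (x : X) : 0 ≤ maxBirkhoffSum T g n x := by
  cases n with
  | zero => exact le_rfl
  | succ n => exact le_max_left _ _

theorem maxBirkhoffSum_le_succ (n : ℕ) (x : X) :
    maxBirkhoffSum T g n x ≤ maxBirkhoffSum T g (n + 1) x := by
  induction n generalizing x with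
  | zero => exact maxBirkhoffSum_nonneg 1 x
  | succ n ih => exact max_le_max le_rfl (add_le_add le_rfl (ih (T x)))

theorem birkhoffSum_le_maxBirkhoffSum (n : ℕ) (x : X) :
    birkhoffSum T g n x ≤ maxBirkhoffSum T g n x := by
  induction n generalizing x with
  | zero => simp [maxBirkhoffSum]
  | succ n ih =>
    rw [birkhoffSum_succ']
    exact le_max_of_le_right (add_le_add le_rfl (ih (T x)))

theorem maxBirkhoffSum_le {C : ℝ} (hC : ∀ x, |g x| ≤ C) (n : ℕ) (x : X) :
    maxBirkhoffSum T g n x ≤ n * C := by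
  induction n generalizing x with
  | zero => simp [maxBirkhoffSum]
  | succ n ih =>
    have h0 : 0 ≤ C := (abs_nonneg _).trans (hC x)
    have h1 := ih (T x)
    have h2 := (abs_le.1 (hC x)).2
    refine max_le (by positivity) ?_
    push_cast
    linarith

theorem abs_birkhoffAverage_le {C : ℝ} (hC : ∀ x, |g x| ≤ C) (n : ℕ) (x : X) :
    |birkhoffSum T g n x / n| ≤ C := by
  have h0 : 0 ≤ C := (abs_nonneg _).trans (hC x)
  rw [abs_div, Nat.abs_cast]
  refine div_le_of_le_mul₀ (Nat.cast_nonneg n) h0 ?_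
  calc |birkhoffSum T g n x| ≤ ∑ k ∈ Finset.range n, |g (T^[k] x)| :=
        Finset.abs_sum_le_sum_abs _ _
    _ ≤ ∑ k ∈ Finset.range n, C := Finset.sum_le_sum fun k _ => hC _
    _ = C * n := by simp [mul_comm]

/-- The sums telescope: only the first and the last term differ, and they are bounded. -/
theorem tendsto_birkhoffAverage_sub {C : ℝ} (hC : ∀ x, |g x| ≤ C) (x : X) :
    Tendsto (fun n : ℕ => birkhoffSum T g n (T x) / n - birkhoffSum T g n x / n) atTop (𝓝 0) := by
  have h : ∀ n : ℕ, ‖birkhoffSum T g n (T x) / n - birkhoffSum T g n x / n‖ ≤ 2 * C / n := by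
    intro n
    rw [← sub_div, birkhoffSum_apply_sub_birkhoffSum, norm_div, Real.norm_natCast]
    refine div_le_div_of_nonneg_right ?_ (Nat.cast_nonneg n)
    calc ‖g (T^[n] x) - g x‖ ≤ |g (T^[n] x)| + |g x| := abs_sub _ _
      _ ≤ 2 * C := by linarith [hC (T^[n] x), hC x]
  exact squeeze_zero_norm h (tendsto_const_div_atTop_nhds_zero_nat _)

theorem frequently_lt_of_tendsto_sub {u v : ℕ → ℝ} (h : Tendsto (fun n => v n - u n) atTop (𝓝 0))
    {a c : ℝ} (hac : a < c) (hu : ∃ᶠ n in atTop, u n < a) : ∃ᶠ n in atTop, v n < c := by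
  have h1 : ∀ᶠ n in atTop, v n - u n < c - a := h.eventually_lt_const (sub_pos.2 hac)
  exact (hu.and_eventually h1).mono fun n hn => by linarith [hn.1, hn.2]

/-- The set of points whose Birkhoff averages drop below a number less than `a` infinitely often,
and exceed a number greater than `b` infinitely often. -/
def birkhoffOscillation (T : X → X) (g : X → ℝ) (a b : ℝ) : Set X :=
  {x | (∃ q : ℚ, (q : ℝ) < a ∧ ∃ᶠ n : ℕ in atTop, birkhoffSum T g n x / n < q) ∧
    ∃ q : ℚ, b < q ∧ ∃ᶠ n : ℕ in atTop, (q : ℝ) < birkhoffSum T g n x / n}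

/-- The rational margins in the definition make the set exactly invariant: averages at `x` and at `T
x` differ by a null sequence, which is absorbed by moving each rational slightly towards `a` or `b`.
-/
theorem preimage_birkhoffOscillation {C : ℝ} (hC : ∀ x, |g x| ≤ C) (a b : ℝ) :
    T ⁻¹' birkhoffOscillation T g a b = birkhoffOscillation T g a b := by
  have key : ∀ u v : ℕ → ℝ, Tendsto (fun n => v n - u n) atTop (𝓝 0) →
      ((∃ q : ℚ, (q : ℝ) < a ∧ ∃ᶠ n : ℕ in atTop, u n < q) ∧
        ∃ q : ℚ, b < q ∧ ∃ᶠ n : ℕ in atTop, (q : ℝ) < u n) →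
      ((∃ q : ℚ, (q : ℝ) < a ∧ ∃ᶠ n : ℕ in atTop, v n < q) ∧
        ∃ q : ℚ, b < q ∧ ∃ᶠ n : ℕ in atTop, (q : ℝ) < v n) := by
    rintro u v h ⟨⟨q, hq, hu⟩, r, hr, hu'⟩
    obtain ⟨q', hq', hqa⟩ := exists_rat_btwn hq
    obtain ⟨r', hr', hrb⟩ := exists_rat_btwn hr
    refine ⟨⟨q', hqa, frequently_lt_of_tendsto_sub h hq' hu⟩, r', hr', ?_⟩
    have h' : Tendsto (fun n => -v n - -u n) atTop (𝓝 0) := by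
      simpa [sub_eq_add_neg, add_comm] using h.neg
    have := frequently_lt_of_tendsto_sub h' (neg_lt_neg hrb)
      (hu'.mono fun n hn => neg_lt_neg hn)
    exact this.mono fun n hn => neg_lt_neg_iff.1 hn
  ext x
  have h := tendsto_birkhoffAverage_sub (T := T) hC x
  refine ⟨key _ _ ?_, key _ _ h⟩
  simpa using h.neg

variable [MeasurableSpace X] {μ : Measure X}

theorem measurable_maxBirkhoffSum (hT : Measurable T) (hg : Measurable g) (n : ℕ) :
    Measurable (maxBirkhoffSum T g n) := by
  induction n with
  | zero => exact measurable_const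
  | succ n ih => exact measurable_const.max (hg.add (ih.comp hT))

theorem integrable_of_abs_le [IsFiniteMeasure μ] (hg : Measurable g) {C : ℝ}
    (hC : ∀ x, |g x| ≤ C) : Integrable g μ :=
  Integrable.of_bound hg.aestronglyMeasurable C (Eventually.of_forall hC)

theorem integrable_maxBirkhoffSum [IsFiniteMeasure μ] (hT : Measurable T) (hg : Measurable g)
    {C : ℝ} (hC : ∀ x, |g x| ≤ C) (n : ℕ) : Integrable (maxBirkhoffSum T g n) μ := by
  refine integrable_of_abs_le (measurable_maxBirkhoffSum hT hg n) (C := n * C) fun x => ?_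
  rw [abs_of_nonneg (maxBirkhoffSum_nonneg n x)]
  exact maxBirkhoffSum_le hC n x

/-- The maximal ergodic theorem for bounded functions. -/
theorem setIntegral_maxBirkhoffSum_pos_nonneg [IsFiniteMeasure μ] (hT : MeasurePreserving T μ μ)
    (hg : Measurable g) {C : ℝ} (hC : ∀ x, |g x| ≤ C) (n : ℕ) :
    0 ≤ ∫ x in {x | 0 < maxBirkhoffSum T g (n + 1) x}, g x ∂μ := by
  have hM := fun n => integrable_maxBirkhoffSum (μ := μ) hT.measurable hg hC n
  have hmeas : MeasurableSet {x | 0 < maxBirkhoffSum T g (n + 1) x} :=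
    measurableSet_lt measurable_const (measurable_maxBirkhoffSum hT.measurable hg _)
  have hcomp : Integrable (fun x => maxBirkhoffSum T g n (T x)) μ :=
    hT.integrable_comp_of_integrable (hM n)
  have hint : ∫ x, maxBirkhoffSum T g n (T x) ∂μ = ∫ x, maxBirkhoffSum T g n x ∂μ := by
    have := integral_map (μ := μ) hT.measurable.aemeasurable
      (f := maxBirkhoffSum T g n) (by rw [hT.map_eq]; exact (hM n).aestronglyMeasurable)
    rw [hT.map_eq] at this
    exact this.symm
  have h1 : ∫ x, maxBirkhoffSum T g n x ∂μ ≤ ∫ x, maxBirkhoffSum T g (n + 1) x ∂μ :=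
    integral_mono (hM n) (hM (n + 1)) fun x => maxBirkhoffSum_le_succ n x
  rw [← integral_indicator hmeas]
  -- Garsia's argument: where the maximum is positive the integrand on the left equals `g x`,
  -- elsewhere it is at most 0. By invariance of `μ` its integral is that of an increment of a
  -- nondecreasing sequence.
  have h2 : ∫ x, (maxBirkhoffSum T g (n + 1) x - maxBirkhoffSum T g n (T x)) ∂μ ≤
      ∫ x, {x | 0 < maxBirkhoffSum T g (n + 1) x}.indicator g x ∂μ := by
    refine integral_mono ((hM _).sub hcomp)
      ((integrable_of_abs_le hg hC).indicator hmeas) fun x => ?_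
    by_cases hx : 0 < maxBirkhoffSum T g (n + 1) x
    · rw [indicator_of_mem (by exact hx)]
      have h3 : 0 < g x + maxBirkhoffSum T g n (T x) := by
        rcases lt_max_iff.1 (show 0 < max 0 (g x + maxBirkhoffSum T g n (T x)) from hx) with h | h
        · exact absurd h (lt_irrefl _)
        · exact h
      have h4 : maxBirkhoffSum T g (n + 1) x = g x + maxBirkhoffSum T g n (T x) :=
        max_eq_right h3.le
      rw [h4]
      simp
    · rw [indicator_of_notMem (by exact hx)]
      have h3 := maxBirkhoffSum_nonneg (T := T) (g := g) n (T x)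
      linarith
  rw [integral_sub (hM _) hcomp, hint] at h2
  linarith

theorem integral_nonneg_of_exists_birkhoffSum_pos [IsFiniteMeasure μ]
    (hT : MeasurePreserving T μ μ) (hg : Measurable g) {C : ℝ} (hC : ∀ x, |g x| ≤ C)
    (h : ∀ᵐ x ∂μ, ∃ n, 0 < birkhoffSum T g n x) : 0 ≤ ∫ x, g x ∂μ := by
  have hmeas : ∀ n, MeasurableSet {x | 0 < maxBirkhoffSum T g (n + 1) x} := fun n =>
    measurableSet_lt measurable_const (measurable_maxBirkhoffSum hT.measurable hg _)
  have hlim : Tendsto (fun n : ℕ => ∫ x, {x | 0 < maxBirkhoffSum T g (n + 1) x}.indicator g x ∂μ)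
      atTop (𝓝 (∫ x, g x ∂μ)) := by
    refine tendsto_integral_of_dominated_convergence (fun _ => C)
      (fun n => (hg.indicator (hmeas n)).aestronglyMeasurable) (integrable_const _)
      (fun n => Eventually.of_forall fun x => ?_) ?_
    · exact (norm_indicator_le_norm_self _ _).trans (hC x)
    · filter_upwards [h] with x ⟨n, hn⟩
      refine tendsto_const_nhds.congr' ?_
      filter_upwards [eventually_ge_atTop n] with m hm
      refine (indicator_of_mem (show x ∈ {x | 0 < maxBirkhoffSum T g (m + 1) x} from ?_) _).symm
      have hmono : Monotone fun k => maxBirkhoffSum T g k x :=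
        monotone_nat_of_le_succ fun k => maxBirkhoffSum_le_succ k x
      exact hn.trans_le ((birkhoffSum_le_maxBirkhoffSum n x).trans (hmono (hm.trans m.le_succ)))
  refine ge_of_tendsto' hlim fun n => ?_
  rw [integral_indicator (hmeas n)]
  exact setIntegral_maxBirkhoffSum_pos_nonneg hT hg hC n

/-- The maximal inequality for `g - b` and for `a - g` gives b μ(X) ≤ ∫ g ≤ a μ(X), impossible for a
< b unless μ(X) = 0. -/
theorem measure_univ_eq_zero_of_birkhoffAverage_gap [IsFiniteMeasure μ]
    (hT : MeasurePreserving T μ μ) (hg : Measurable g) {C : ℝ} (hC : ∀ x, |g x| ≤ C) {a b : ℝ}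
    (hab : a < b) (h : ∀ᵐ x ∂μ, (∃ n : ℕ, birkhoffSum T g n x < n * a) ∧
      ∃ n : ℕ, n * b < birkhoffSum T g n x) : μ univ = 0 := by
  have hgi : Integrable g μ := integrable_of_abs_le hg hC
  have hsum : ∀ (c : ℝ) (n : ℕ) x, birkhoffSum T (fun y => g y - c) n x =
      birkhoffSum T g n x - n * c := fun c n x => by
    simp [birkhoffSum, Finset.sum_sub_distrib]
  have hsum' : ∀ (c : ℝ) (n : ℕ) x, birkhoffSum T (fun y => c - g y) n x =
      n * c - birkhoffSum T g n x := fun c n x => by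
    simp [birkhoffSum, Finset.sum_sub_distrib]
  have h1 : 0 ≤ ∫ x, (g x - b) ∂μ := by
    refine integral_nonneg_of_exists_birkhoffSum_pos hT (hg.sub_const b) (C := C + |b|)
      (fun x => (abs_sub _ _).trans (add_le_add (hC x) le_rfl)) ?_
    filter_upwards [h] with x ⟨_, n, hn⟩
    exact ⟨n, by rw [hsum]; linarith⟩
  have h2 : 0 ≤ ∫ x, (a - g x) ∂μ := by
    refine integral_nonneg_of_exists_birkhoffSum_pos hT (hg.const_sub a) (C := |a| + C)
      (fun x => (abs_sub _ _).trans (add_le_add le_rfl (hC x))) ?_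
    filter_upwards [h] with x ⟨⟨n, hn⟩, _⟩
    exact ⟨n, by rw [hsum']; linarith⟩
  rw [integral_sub hgi (integrable_const _)] at h1
  rw [integral_sub (integrable_const _) hgi] at h2
  simp only [integral_const, smul_eq_mul] at h1 h2
  have h3 : μ.real univ * (b - a) ≤ 0 := by linarith
  have h4 : μ.real univ ≤ 0 := by
    by_contra! h5
    have := mul_pos h5 (sub_pos.2 hab)
    linarith
  have h5 : μ.real univ = 0 := le_antisymm h4 measureReal_nonneg
  exact (measureReal_eq_zero_iff (measure_ne_top _ _)).1 h5

theorem measurable_birkhoffSum (hT : Measurable T) (hg : Measurable g) (n : ℕ) :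
    Measurable (birkhoffSum T g n) := by
  unfold birkhoffSum
  exact Finset.measurable_sum _ fun k _ => hg.comp (hT.iterate k)

theorem measurableSet_birkhoffOscillation (hT : Measurable T) (hg : Measurable g) (a b : ℝ) :
    MeasurableSet (birkhoffOscillation T g a b) := by
  have hm : ∀ n : ℕ, Measurable fun x => birkhoffSum T g n x / n := fun n =>
    (measurable_birkhoffSum hT hg n).div_const _
  simp only [birkhoffOscillation, frequently_atTop, ofPred_and, ofPred_exists, ofPred_forall]
  refine MeasurableSet.inter ?_ ?_
  · exact MeasurableSet.iUnion fun q => (MeasurableSet.const _).inter <|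
      MeasurableSet.iInter fun n => MeasurableSet.iUnion fun k => (MeasurableSet.const _).inter <|
        measurableSet_lt (hm k) measurable_const
  · exact MeasurableSet.iUnion fun q => (MeasurableSet.const _).inter <|
      MeasurableSet.iInter fun n => MeasurableSet.iUnion fun k => (MeasurableSet.const _).inter <|
        measurableSet_lt measurable_const (hm k)

/-- **Birkhoff's ergodic theorem**, for bounded functions on a finite measure space: the time
averages converge almost everywhere. -/
theorem ae_exists_tendsto_birkhoffAverage [IsFiniteMeasure μ] (hT : MeasurePreserving T μ μ)
    (hg : Measurable g) {C : ℝ} (hC : ∀ x, |g x| ≤ C) :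
    ∀ᵐ x ∂μ, ∃ c, Tendsto (fun n : ℕ => birkhoffSum T g n x / n) atTop (𝓝 c) := by
  have hnull : ∀ a b : ℚ, a < b → μ (birkhoffOscillation T g a b) = 0 := by
    intro a b hab
    have hE := measurableSet_birkhoffOscillation hT.measurable hg (a : ℝ) b
    -- The oscillation set is invariant, so the gap lemma applies to the measure restricted to it.
    have hT' := hT.restrict_preimage hE
    rw [preimage_birkhoffOscillation hC] at hT'
    have := measure_univ_eq_zero_of_birkhoffAverage_gap hT' hg hC
      (show (a : ℝ) < b by exact_mod_cast hab) ?_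
    · simpa using this
    · filter_upwards [ae_restrict_mem hE] with x hx
      obtain ⟨⟨q, hq, hu⟩, r, hr, hu'⟩ := hx
      obtain ⟨n, hn, hn0⟩ := (hu.and_eventually (eventually_gt_atTop 0)).exists
      obtain ⟨m, hm, hm0⟩ := (hu'.and_eventually (eventually_gt_atTop 0)).exists
      have hn0' : (0 : ℝ) < n := Nat.cast_pos.2 hn0
      have hm0' : (0 : ℝ) < m := Nat.cast_pos.2 hm0
      refine ⟨⟨n, ?_⟩, m, ?_⟩
      · rw [mul_comm]
        exact (div_lt_iff₀ hn0').1 (hn.trans hq)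
      · rw [mul_comm]
        exact (lt_div_iff₀ hm0').1 (hr.trans hm)
  have hall : ∀ᵐ x ∂μ, ∀ a b : ℚ, a < b → x ∉ birkhoffOscillation T g a b := by
    simp only [ae_all_iff]
    exact fun a b hab => measure_eq_zero_iff_ae_notMem.1 (hnull a b hab)
  filter_upwards [hall] with x hx
  refine tendsto_of_no_upcrossings (s := range ((↑) : ℚ → ℝ)) Rat.denseRange_cast ?_ ?_ ?_
  · rintro _ ⟨a, rfl⟩ _ ⟨b, rfl⟩ hab ⟨h1, h2⟩
    have hab' : a < b := by exact_mod_cast hab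
    -- The intermediate pair c < d leaves the strict margins that `birkhoffOscillation` requires.
    obtain ⟨c, hac, hcb⟩ := exists_between hab'
    obtain ⟨d, hcd, hdb⟩ := exists_between hcb
    exact hx c d hcd ⟨⟨a, by exact_mod_cast hac, h1⟩, b, by exact_mod_cast hdb, h2⟩
  · exact ⟨C, eventually_map.2 (Eventually.of_forall fun n =>
      (abs_le.1 (abs_birkhoffAverage_le hC n x)).2)⟩
  · exact ⟨-C, eventually_map.2 (Eventually.of_forall fun n =>
      (abs_le.1 (abs_birkhoffAverage_le hC n x)).1)⟩

end Birkhoff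

variable {Ω : Set ℂ} {L : ℝ} {γ : ℝ → ℂ}

/-! ### Time reversal -/

/-- Time reversal on the phase space. -/
noncomputable def reversal (z : ℝ × ℝ) : ℝ × ℝ := (z.1, Real.pi - z.2)

@[simp]
theorem reversal_fst (z : ℝ × ℝ) : (reversal z).1 = z.1 := rfl

@[simp]
theorem reversal_snd (z : ℝ × ℝ) : (reversal z).2 = Real.pi - z.2 := rfl

@[simp]
theorem reversal_reversal (z : ℝ × ℝ) : reversal (reversal z) = z := by
  ext <;> simp

theorem measurable_reversal : Measurable reversal :=
  measurable_fst.prodMk (measurable_const.sub measurable_snd)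

theorem reversal_mem_smoothPhase {z : ℝ × ℝ} (hz : z ∈ smoothPhase L γ) :
    reversal z ∈ smoothPhase L γ :=
  ⟨hz.1, hz.2.1, by simpa using hz.2.2.2, by simpa using hz.2.2.1⟩

theorem outVelocity_reversal (z : ℝ × ℝ) : outVelocity γ (reversal z) = -inVelocity γ z := by
  simp only [outVelocity, inVelocity, reversal_fst, reversal_snd]
  rw [show (((Real.pi - z.2 : ℝ) : ℂ) * Complex.I) = Real.pi * Complex.I + -(z.2 * Complex.I) by
    push_cast; ring, Complex.exp_add, Complex.exp_pi_mul_I]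
  ring

theorem inVelocity_reversal (z : ℝ × ℝ) : inVelocity γ (reversal z) = -outVelocity γ z := by
  have h := outVelocity_reversal (γ := γ) (reversal z)
  rw [reversal_reversal] at h
  rw [h, neg_neg]

/-- The same chord is traversed from the other end, with parameter t - u, and reversal exchanges
incoming and outgoing velocities up to sign. -/
theorem Step.reverse {z w : ℝ × ℝ} (h : Step Ω L γ z w) :
    Step Ω L γ (reversal w) (reversal z) := by
  obtain ⟨hz, hw, ⟨t, ht, hγ, hΩ⟩, hv⟩ := h
  have hv' : outVelocity γ (reversal w) = -outVelocity γ z := by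
    rw [outVelocity_reversal, hv]
  refine ⟨reversal_mem_smoothPhase hw, reversal_mem_smoothPhase hz, ⟨t, ht, ?_, ?_⟩, ?_⟩
  · rw [hv', reversal_fst, reversal_fst, hγ]
    ring
  · intro u hu
    rw [hv', reversal_fst, hγ]
    have := hΩ (t - u) ⟨by linarith [hu.2], by linarith [hu.1]⟩
    convert this using 1
    push_cast
    ring
  · rw [hv', inVelocity_reversal]

/-! ### Uniqueness of the next collision -/

namespace IsBoundaryParam

theorem notMem_of_isOpen (hγ : IsBoundaryParam Ω L γ) (hopen : IsOpen Ω) (s : ℝ) : γ s ∉ Ω := by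
  have h : γ s ∈ frontier Ω := hγ.range_eq ▸ mem_range_self s
  rw [hopen.frontier_eq] at h
  exact h.2

theorem norm_outVelocity (hγ : IsBoundaryParam Ω L γ) {z : ℝ × ℝ} (hz : ContDiffAt ℝ 1 γ z.1) :
    ‖outVelocity γ z‖ = 1 := by
  rw [outVelocity, norm_mul, hγ.unit_speed _ hz, Complex.norm_exp_ofReal_mul_I, mul_one]

theorem deriv_ne_zero (hγ : IsBoundaryParam Ω L γ) {s : ℝ} (hs : ContDiffAt ℝ 1 γ s) :
    deriv γ s ≠ 0 := by
  rw [← norm_ne_zero_iff, hγ.unit_speed s hs]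
  exact one_ne_zero

end IsBoundaryParam

theorem exp_mul_I_injOn_Ioo {θ θ' : ℝ} (hθ : θ ∈ Ioo 0 Real.pi) (hθ' : θ' ∈ Ioo 0 Real.pi)
    (h : Complex.exp (-(θ * Complex.I)) = Complex.exp (-(θ' * Complex.I))) : θ = θ' := by
  have h1 := congrArg Complex.re (inv_inj.1 (by simpa only [Complex.exp_neg] using h))
  rw [Complex.exp_ofReal_mul_I_re, Complex.exp_ofReal_mul_I_re] at h1
  exact Real.injOn_cos (Ioo_subset_Icc_self hθ) (Ioo_subset_Icc_self hθ') h1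

namespace IsBoundaryParam

/-- Of two different hitting times the earlier would be a boundary point inside the open set Ω.
Footpoint and incoming velocity then determine the angle. -/
theorem step_unique (hγ : IsBoundaryParam Ω L γ) (hopen : IsOpen Ω) {z w w' : ℝ × ℝ}
    (h : Step Ω L γ z w) (h' : Step Ω L γ z w') : w = w' := by
  obtain ⟨hz, hw, ⟨t, ht, hγt, hΩ⟩, hv⟩ := h
  obtain ⟨-, hw', ⟨t', ht', hγt', hΩ'⟩, hv'⟩ := h'
  have htt : t = t' := by
    rcases lt_trichotomy t t' with hlt | heq | hlt
    · exact absurd (hγt ▸ hΩ' t ⟨ht, hlt⟩) (hγ.notMem_of_isOpen hopen _)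
    · exact heq
    · exact absurd (hγt' ▸ hΩ t' ⟨ht', hlt⟩) (hγ.notMem_of_isOpen hopen _)
  have h1 : w.1 = w'.1 := hγ.injOn hw.1 hw'.1 (by rw [hγt, hγt', htt])
  refine Prod.ext h1 (exp_mul_I_injOn_Ioo hw.2.2 hw'.2.2 ?_)
  rw [hv, inVelocity, inVelocity, ← h1] at hv'
  exact mul_left_cancel₀ (hγ.deriv_ne_zero hw.2.1) hv'

theorem billiardMap_eq (hγ : IsBoundaryParam Ω L γ) (hopen : IsOpen Ω) {z w : ℝ × ℝ}
    (h : Step Ω L γ z w) : billiardMap Ω L γ z = w := by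
  have hex : ∃ w, Step Ω L γ z w := ⟨w, h⟩
  rw [billiardMap, dif_pos hex]
  exact hγ.step_unique hopen hex.choose_spec h

end IsBoundaryParam

theorem step_billiardMap {z : ℝ × ℝ} (hz : z ∈ mapDomain Ω L γ) :
    Step Ω L γ z (billiardMap Ω L γ z) := by
  have hex : ∃ w, Step Ω L γ z w := hz
  rw [billiardMap, dif_pos hex]
  exact hex.choose_spec

theorem billiardMap_of_notMem {z : ℝ × ℝ} (hz : z ∉ mapDomain Ω L γ) :
    billiardMap Ω L γ z = z :=
  dif_neg hz

/-! ### Measurability of the billiard map -/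

theorem isOpen_setOf_contDiffAt : IsOpen {s | ContDiffAt ℝ 1 γ s} :=
  isOpen_iff_mem_nhds.2 fun _ hs => ContDiffAt.eventually (by exact hs) (by simp)

theorem measurableSet_smoothPhase : MeasurableSet (smoothPhase L γ) := by
  refine (measurableSet_Ico.preimage measurable_fst).inter
    ((isOpen_setOf_contDiffAt.measurableSet.preimage measurable_fst).inter
      (measurableSet_Ioo.preimage measurable_snd))

theorem measurable_outVelocity : Measurable (outVelocity γ) := by
  unfold outVelocity
  exact ((measurable_deriv γ).comp measurable_fst).mul (by fun_prop)

theorem measurable_inVelocity : Measurable (inVelocity γ) := by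
  unfold inVelocity
  exact ((measurable_deriv γ).comp measurable_fst).mul (by fun_prop)

/-- The pairs of points whose open connecting segment lies in an open set form a Borel set. -/
theorem measurableSet_openSegment_subset (hopen : IsOpen Ω) :
    MeasurableSet {q : ℂ × ℂ | ∀ u ∈ Ioo (0 : ℝ) 1, q.1 + u * (q.2 - q.1) ∈ Ω} := by
  -- On a compact parameter interval the condition is open in the end points, by the tube lemma; the
  -- open interval is exhausted by countably many such intervals.
  have h : {q : ℂ × ℂ | ∀ u ∈ Ioo (0 : ℝ) 1, q.1 + u * (q.2 - q.1) ∈ Ω} =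
      ⋂ n : ℕ, {q : ℂ × ℂ | ∀ u ∈ Icc (1 / (n + 1) : ℝ) (1 - 1 / (n + 1)),
        q.1 + u * (q.2 - q.1) ∈ Ω} := by
    ext q
    simp only [mem_iInter]
    constructor
    · intro hq n u hu
      have : (0 : ℝ) < 1 / (n + 1) := Nat.one_div_pos_of_nat
      exact hq u ⟨by linarith [hu.1], by linarith [hu.2]⟩
    · intro hq u hu
      obtain ⟨n, hn⟩ := exists_nat_one_div_lt (lt_min hu.1 (sub_pos.2 hu.2))
      have h1 := lt_min_iff.1 hn
      exact hq n u ⟨h1.1.le, by linarith [h1.2]⟩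
  rw [h]
  refine MeasurableSet.iInter fun n => IsOpen.measurableSet ?_
  rw [isOpen_iff_mem_nhds]
  intro q hq
  refine isCompact_Icc.eventually_forall_of_forall_eventually fun u hu => ?_
  have hc : Continuous fun y : (ℂ × ℂ) × ℝ => y.1.1 + y.2 * (y.1.2 - y.1.1) := by fun_prop
  exact hc.continuousAt.eventually (hopen.mem_nhds (hq u hu))

/-- The flight time is the chord length because velocities are unit vectors. Eliminating it leaves
conditions that are visibly Borel. -/
theorem step_iff (hγ : IsBoundaryParam Ω L γ) {z w : ℝ × ℝ} : Step Ω L γ z w ↔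
    z ∈ smoothPhase L γ ∧ w ∈ smoothPhase L γ ∧ γ z.1 ≠ γ w.1 ∧
      γ w.1 - γ z.1 = ‖γ w.1 - γ z.1‖ * outVelocity γ z ∧
      (∀ u ∈ Ioo (0 : ℝ) 1, γ z.1 + u * (γ w.1 - γ z.1) ∈ Ω) ∧
      outVelocity γ z = inVelocity γ w := by
  constructor
  · rintro ⟨hz, hw, ⟨t, ht, hγt, hΩ⟩, hv⟩
    have hn := hγ.norm_outVelocity hz.2.1
    have hnorm : ‖γ w.1 - γ z.1‖ = t := by
      rw [hγt, add_sub_cancel_left, norm_mul, hn, mul_one, Complex.norm_of_nonneg ht.le]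
    refine ⟨hz, hw, ?_, ?_, ?_, hv⟩
    · intro h
      rw [h, sub_self, norm_zero] at hnorm
      exact ht.ne hnorm
    · rw [hnorm, hγt, add_sub_cancel_left]
    · intro u hu
      rw [hγt, add_sub_cancel_left, ← mul_assoc, ← Complex.ofReal_mul]
      exact hΩ _ ⟨mul_pos hu.1 ht, by nlinarith [hu.2]⟩
  · rintro ⟨hz, hw, hne, hγt, hΩ, hv⟩
    have hpos : 0 < ‖γ w.1 - γ z.1‖ := norm_pos_iff.2 (sub_ne_zero.2 hne.symm)
    refine ⟨hz, hw, ⟨‖γ w.1 - γ z.1‖, hpos, by rw [← hγt]; ring, fun u hu => ?_⟩, hv⟩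
    have := hΩ (u / ‖γ w.1 - γ z.1‖) ⟨div_pos hu.1 hpos, (div_lt_one hpos).2 hu.2⟩
    have hmul : ((u / ‖γ w.1 - γ z.1‖ : ℝ) : ℂ) * (γ w.1 - γ z.1) =
        (u / ‖γ w.1 - γ z.1‖ : ℝ) * (‖γ w.1 - γ z.1‖ * outVelocity γ z) := by rw [← hγt]
    rw [hmul] at this
    convert this using 2
    have hne' : (‖γ w.1 - γ z.1‖ : ℂ) ≠ 0 := by exact_mod_cast hpos.ne'
    push_cast
    rw [← mul_assoc, div_mul_cancel₀ _ hne']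

theorem measurableSet_step (hopen : IsOpen Ω) (hγ : IsBoundaryParam Ω L γ) :
    MeasurableSet {q : (ℝ × ℝ) × (ℝ × ℝ) | Step Ω L γ q.1 q.2} := by
  have hc := hγ.continuous.measurable
  have h1 : Measurable fun q : (ℝ × ℝ) × (ℝ × ℝ) => γ q.1.1 :=
    hc.comp (measurable_fst.comp measurable_fst)
  have h2 : Measurable fun q : (ℝ × ℝ) × (ℝ × ℝ) => γ q.2.1 :=
    hc.comp (measurable_fst.comp measurable_snd)
  have h3 : Measurable fun q : (ℝ × ℝ) × (ℝ × ℝ) => outVelocity γ q.1 :=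
    measurable_outVelocity.comp measurable_fst
  have h4 : Measurable fun q : (ℝ × ℝ) × (ℝ × ℝ) => inVelocity γ q.2 :=
    measurable_inVelocity.comp measurable_snd
  simp only [step_iff hγ]
  refine (measurableSet_smoothPhase.preimage measurable_fst).inter
    ((measurableSet_smoothPhase.preimage measurable_snd).inter
    ((measurableSet_eq_fun h1 h2).compl.inter ((measurableSet_eq_fun (h2.sub h1) ?_).inter
    (((measurableSet_openSegment_subset hopen).preimage (h1.prodMk h2)).inter
    (measurableSet_eq_fun h3 h4)))))
  exact (Complex.measurable_ofReal.comp (h2.sub h1).norm).mul h3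

/-- Lusin–Souslin: a projection of a Borel set is Borel if it is injective there, and injectivity is
`step_unique`. -/
theorem measurableSet_image_step (hopen : IsOpen Ω) (hγ : IsBoundaryParam Ω L γ)
    {B : Set (ℝ × ℝ)} (hB : MeasurableSet B) :
    MeasurableSet {z | ∃ w ∈ B, Step Ω L γ z w} := by
  have h := ((measurableSet_step hopen hγ).inter (hB.preimage
    measurable_snd)).image_of_measurable_injOn measurable_fst (fun q hq q' hq' h =>
      Prod.ext h (hγ.step_unique hopen (z := q.1) hq.1 (by rw [h]; exact hq'.1)))
  convert h using 1
  ext z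
  constructor
  · rintro ⟨w, hw, hs⟩
    exact ⟨(z, w), ⟨hs, hw⟩, rfl⟩
  · rintro ⟨⟨z', w⟩, ⟨hs, hw⟩, rfl⟩
    exact ⟨w, hw, hs⟩

theorem measurableSet_mapDomain (hopen : IsOpen Ω) (hγ : IsBoundaryParam Ω L γ) :
    MeasurableSet (mapDomain Ω L γ) := by
  have h := measurableSet_image_step hopen hγ MeasurableSet.univ
  simp only [mem_univ, true_and] at h
  exact h

theorem measurable_billiardMap (hopen : IsOpen Ω) (hγ : IsBoundaryParam Ω L γ) :
    Measurable (billiardMap Ω L γ) := by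
  intro B hB
  have h : billiardMap Ω L γ ⁻¹' B =
      {z | ∃ w ∈ B, Step Ω L γ z w} ∪ B \ mapDomain Ω L γ := by
    ext z
    by_cases hz : z ∈ mapDomain Ω L γ
    · constructor
      · exact fun h => Or.inl ⟨_, h, step_billiardMap hz⟩
      · rintro (⟨w, hw, hs⟩ | h)
        · rw [mem_preimage, hγ.billiardMap_eq hopen hs]
          exact hw
        · exact absurd hz h.2
    · constructor
      · intro h
        rw [mem_preimage, billiardMap_of_notMem hz] at h
        exact Or.inr ⟨h, hz⟩
      · rintro (⟨w, hw, hs⟩ | h)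
        · exact absurd ⟨w, hs⟩ hz
        · rw [mem_preimage, billiardMap_of_notMem hz]
          exact h.1
  rw [h]
  exact (measurableSet_image_step hopen hγ hB).union
    (hB.diff (measurableSet_mapDomain hopen hγ))

/-! ### Local geometry at a smooth boundary point -/

/-- The component of the velocity `v` along the inner normal at the boundary point `s`. -/
noncomputable def normalSpeed (γ : ℝ → ℂ) (v : ℂ) (s : ℝ) : ℝ := (v * conj (deriv γ s)).im

/-- The coordinate of `x` transverse to the direction `v`. -/
def transverse (v x : ℂ) : ℝ := (x * conj v).im

/-- The phase point with footpoint `s` and outgoing velocity `v`. -/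
noncomputable def phasePoint (γ : ℝ → ℂ) (v : ℂ) (s : ℝ) : ℝ × ℝ :=
  (s, Complex.arg (v * conj (deriv γ s)))

namespace IsBoundaryParam

theorem eq_of_map_eq (hγ : IsBoundaryParam Ω L γ) {s s₀ : ℝ} (h : γ s = γ s₀)
    (hs : |s - s₀| ≤ L / 2) : s = s₀ := by
  have hL := hγ.perimeter_pos
  have hmod : ∀ s, γ (toIcoMod hL 0 s) = γ s := fun s => by
    have := hγ.periodic.zsmul (toIcoDiv hL 0 s) (toIcoMod hL 0 s)
    rwa [toIcoMod_add_toIcoDiv_zsmul, eq_comm] at this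
  have hmem : ∀ s, toIcoMod hL 0 s ∈ Ico 0 L := fun s => by
    simpa using toIcoMod_mem_Ico hL 0 s
  have h1 : toIcoMod hL 0 s = toIcoMod hL 0 s₀ :=
    hγ.injOn (hmem s) (hmem s₀) (by rw [hmod, hmod, h])
  have h2 := toIcoMod_add_toIcoDiv_zsmul hL 0 s
  have h3 := toIcoMod_add_toIcoDiv_zsmul hL 0 s₀
  have h4 : s - s₀ = ((toIcoDiv hL 0 s - toIcoDiv hL 0 s₀ : ℤ) : ℝ) * L := by
    rw [zsmul_eq_mul] at h2 h3
    push_cast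
    linarith
  generalize toIcoDiv hL 0 s - toIcoDiv hL 0 s₀ = n at h4
  rcases eq_or_ne n 0 with rfl | hn
  · simp at h4
    linarith
  · have h5 : (1 : ℝ) ≤ |(n : ℝ)| := by exact_mod_cast Int.one_le_abs hn
    rw [h4, abs_mul, abs_of_pos hL] at hs
    nlinarith

theorem exists_mem_Ico (hγ : IsBoundaryParam Ω L γ) {x : ℂ} (hx : x ∈ frontier Ω) :
    ∃ s ∈ Ico 0 L, γ s = x := by
  rw [← hγ.range_eq] at hx
  obtain ⟨s, rfl⟩ := hx
  obtain ⟨y, hy, h⟩ := hγ.periodic.exists_mem_Ico₀ hγ.perimeter_pos s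
  exact ⟨y, hy, h.symm⟩

/-- Near a smooth boundary point the curve stays away from any compact set of directions that are
transverse to the tangent. -/
theorem eventually_forall_notMem_frontier (hγ : IsBoundaryParam Ω L γ) {s₀ : ℝ}
    (hs : ContDiffAt ℝ 1 γ s₀) {K : Set ℂ} (hK : IsCompact K)
    (hK0 : ∀ d ∈ K, normalSpeed γ d s₀ ≠ 0) :
    ∀ᶠ u : ℝ in 𝓝[>] 0, ∀ d ∈ K, γ s₀ + u * d ∉ frontier Ω := by
  have hL := hγ.perimeter_pos
  set τ := deriv γ s₀ with hτ
  have hτ1 : ‖τ‖ = 1 := hγ.unit_speed s₀ hs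
  have hτc : ‖conj τ‖ = 1 := by rw [RCLike.norm_conj, hτ1]
  obtain ⟨δ, hδ, hδK⟩ : ∃ δ, 0 < δ ∧ ∀ d ∈ K, δ ≤ |normalSpeed γ d s₀| := by
    refine hK.exists_forall_le' (f := fun d => |normalSpeed γ d s₀|) ?_
      fun d hd => abs_pos.2 (hK0 d hd)
    unfold normalSpeed
    fun_prop
  obtain ⟨M, hM, hMK⟩ : ∃ M, 0 < M ∧ ∀ d ∈ K, ‖d‖ ≤ M := hK.isBounded.exists_pos_norm_le
  -- A boundary point `γ s = γ s₀ + u * d` near `γ s₀` differs from the tangent approximation by at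
  -- most c|s - s₀|. The bound c ≤ 1/2 gives |s - s₀| ≤ 2uM, and c ≤ δ/(4M) then bounds the normal
  -- component by uδ/2, although it is at least uδ.
  set c := min (1 / 2) (δ / (4 * M)) with hc
  have hc0 : 0 < c := by positivity
  have hc1 : c ≤ 1 / 2 := min_le_left _ _
  have hc2 : c * (4 * M) ≤ δ := (le_div_iff₀ (by positivity)).1 (min_le_right _ _)
  have hder : HasDerivAt γ τ s₀ := (hs.differentiableAt one_ne_zero).hasDerivAt
  obtain ⟨η, hη, hηc⟩ := Metric.eventually_nhds_iff.1
    ((hasDerivAt_iff_isLittleO.1 hder).def hc0)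
  -- `F` is the part of the curve with parameter far from `s₀`. Being compact and missing `γ s₀`, it
  -- misses a ball, so boundary points close to `γ s₀` have parameters close to `s₀`.
  set F := γ '' (Icc (s₀ - L / 2) (s₀ + L / 2) \ Metric.ball s₀ η) with hF
  have hFc : IsClosed F :=
    ((isCompact_Icc.diff Metric.isOpen_ball).image hγ.continuous).isClosed
  have hF0 : γ s₀ ∉ F := by
    rintro ⟨s, ⟨hs1, hs2⟩, h⟩
    have := hγ.eq_of_map_eq h (abs_le.2 ⟨by linarith [hs1.1], by linarith [hs1.2]⟩)
    exact hs2 (this ▸ Metric.mem_ball_self hη)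
  obtain ⟨r, hr, hrF⟩ := Metric.isOpen_iff.1 hFc.isOpen_compl _ hF0
  filter_upwards [Ioo_mem_nhdsGT (show (0 : ℝ) < r / M by positivity)] with u hu d hd hmem
  have hu0 : 0 < u := hu.1
  have huM : u * M < r := (lt_div_iff₀ hM).1 hu.2
  have hnorm : ‖(u : ℂ) * d‖ ≤ u * M := by
    rw [norm_mul, Complex.norm_of_nonneg hu0.le]
    exact mul_le_mul_of_nonneg_left (hMK d hd) hu0.le
  have hsurj : frontier Ω = γ '' Icc (s₀ - L / 2) (s₀ + L / 2) := by
    rw [← hγ.range_eq, ← hγ.periodic.image_Icc hL (s₀ - L / 2)]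
    congr 2
    ring
  rw [hsurj] at hmem
  obtain ⟨s, hsI, hsγ⟩ := hmem
  have hball : γ s ∈ Metric.ball (γ s₀) r := by
    rw [mem_ball_iff_norm, hsγ, add_sub_cancel_left]
    exact hnorm.trans_lt huM
  have hsη : s ∈ Metric.ball s₀ η := by
    by_contra h
    exact hrF hball ⟨s, ⟨hsI, h⟩, rfl⟩
  have h1 := hηc hsη
  rw [hsγ, add_sub_cancel_left, Real.norm_eq_abs, Complex.real_smul] at h1
  have h2 : |s - s₀| ≤ u * M + c * |s - s₀| := by
    calc |s - s₀| = ‖((s - s₀ : ℝ) : ℂ) * τ‖ := by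
          rw [norm_mul, hτ1, mul_one, Complex.norm_real, Real.norm_eq_abs]
      _ ≤ ‖(u : ℂ) * d‖ + ‖(u : ℂ) * d - ((s - s₀ : ℝ) : ℂ) * τ‖ := by
          have := norm_sub_le ((u : ℂ) * d) ((u : ℂ) * d - ((s - s₀ : ℝ) : ℂ) * τ)
          simpa using this
      _ ≤ _ := add_le_add hnorm h1
  have h3 : u * δ ≤ c * |s - s₀| := by
    have him : (((u : ℂ) * d - ((s - s₀ : ℝ) : ℂ) * τ) * conj τ).im = u * normalSpeed γ d s₀ := by
      rw [sub_mul, mul_assoc, mul_assoc, Complex.mul_conj, Complex.sub_im, Complex.im_ofReal_mul,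
        ← Complex.ofReal_mul, Complex.ofReal_im, sub_zero, normalSpeed]
    calc u * δ ≤ u * |normalSpeed γ d s₀| := mul_le_mul_of_nonneg_left (hδK d hd) hu0.le
      _ = |u * normalSpeed γ d s₀| := by rw [abs_mul, abs_of_pos hu0]
      _ ≤ ‖((u : ℂ) * d - ((s - s₀ : ℝ) : ℂ) * τ) * conj τ‖ := by
          rw [← him]
          exact Complex.abs_im_le_norm _
      _ ≤ c * |s - s₀| := by rwa [norm_mul, hτc, mul_one]
  have h4 : |s - s₀| ≤ 2 * (u * M) := by nlinarith [abs_nonneg (s - s₀)]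
  have h5 : u * δ ≤ c * (2 * (u * M)) := h3.trans (mul_le_mul_of_nonneg_left h4 hc0.le)
  nlinarith [mul_pos hu0 hδ]

end IsBoundaryParam

theorem subset_of_isPreconnected_of_disjoint_frontier {X : Type*} [TopologicalSpace X] {S U : Set X}
    (hS : IsPreconnected S) (hU : IsOpen U) (hd : Disjoint S (frontier U))
    (hne : (S ∩ U).Nonempty) : S ⊆ U := by
  refine hS.subset_left_of_subset_union hU
    (isClosed_closure (s := U)).isOpen_compl ?_ ?_ hne
  · exact disjoint_compl_right.mono_left subset_closure
  · intro x hx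
    by_cases h : x ∈ U
    · exact Or.inl h
    · refine Or.inr fun hc => disjoint_left.1 hd hx ?_
      rw [hU.frontier_eq]
      exact ⟨hc, h⟩

namespace IsBoundaryParam

/-- Two directions on the same side of the tangent at a smooth boundary point both enter `Ω`, or
both do not. -/
theorem eventually_mem_iff_mem (hγ : IsBoundaryParam Ω L γ) (hopen : IsOpen Ω) {s₀ : ℝ}
    (hs : ContDiffAt ℝ 1 γ s₀) {v w : ℂ} (hvw : 0 < normalSpeed γ v s₀ * normalSpeed γ w s₀) :
    ∀ᶠ u : ℝ in 𝓝[>] 0, (γ s₀ + u * v ∈ Ω ↔ γ s₀ + u * w ∈ Ω) := by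
  have hK : IsCompact (segment ℝ v w) := by
    rw [segment_eq_image_lineMap]
    exact isCompact_Icc.image AffineMap.lineMap_continuous
  have hK0 : ∀ d ∈ segment ℝ v w, normalSpeed γ d s₀ ≠ 0 := by
    rintro d ⟨a, b, ha, hb, hab, rfl⟩ h0
    have hlin : normalSpeed γ (a • v + b • w) s₀ =
        a * normalSpeed γ v s₀ + b * normalSpeed γ w s₀ := by
      simp only [normalSpeed, Complex.real_smul, add_mul, mul_assoc, Complex.add_im,
        Complex.im_ofReal_mul]
    rw [hlin] at h0
    rcases pos_and_pos_or_neg_and_neg_of_mul_pos hvw with ⟨h1, h2⟩ | ⟨h1, h2⟩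
    · rcases ha.lt_or_eq with ha' | rfl
      · nlinarith [mul_pos ha' h1, mul_nonneg hb h2.le]
      · simp only [zero_add] at hab
        rw [hab] at h0
        linarith
    · rcases ha.lt_or_eq with ha' | rfl
      · nlinarith [mul_pos ha' (neg_pos.2 h1), mul_nonneg hb (neg_pos.2 h2).le]
      · simp only [zero_add] at hab
        rw [hab] at h0
        linarith
  filter_upwards [hγ.eventually_forall_notMem_frontier hs hK hK0] with u hu
  -- The scaled segment of directions is connected and misses the boundary, so it lies wholly in Ω
  -- or wholly outside.
  set S := (fun d : ℂ => γ s₀ + u * d) '' segment ℝ v w with hS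
  have hSc : IsPreconnected S :=
    (convex_segment v w).isPreconnected.image _ (by fun_prop)
  have hSd : Disjoint S (frontier Ω) := by
    rw [disjoint_left]
    rintro _ ⟨d, hd, rfl⟩
    exact hu d hd
  have hv : γ s₀ + u * v ∈ S := ⟨v, left_mem_segment ℝ v w, rfl⟩
  have hw : γ s₀ + u * w ∈ S := ⟨w, right_mem_segment ℝ v w, rfl⟩
  exact ⟨fun h => subset_of_isPreconnected_of_disjoint_frontier hSc hopen hSd ⟨_, hv, h⟩ hw,
    fun h => subset_of_isPreconnected_of_disjoint_frontier hSc hopen hSd ⟨_, hw, h⟩ hv⟩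

theorem normalSpeed_I_mul_deriv (hγ : IsBoundaryParam Ω L γ) {s : ℝ} (hs : ContDiffAt ℝ 1 γ s) :
    normalSpeed γ (Complex.I * deriv γ s) s = 1 := by
  rw [normalSpeed, mul_assoc, Complex.mul_conj, Complex.normSq_eq_norm_sq, hγ.unit_speed s hs]
  simp

/-- The orientation hypothesis concerns only the normal; comparison on the same side of the tangent
extends it to every inward direction. -/
theorem eventually_mem (hγ : IsBoundaryParam Ω L γ) (hopen : IsOpen Ω) {s : ℝ}
    (hs : ContDiffAt ℝ 1 γ s) {v : ℂ} (hv : 0 < normalSpeed γ v s) :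
    ∀ᶠ u : ℝ in 𝓝[>] 0, γ s + u * v ∈ Ω := by
  have h := hγ.eventually_mem_iff_mem hopen hs (v := v) (w := Complex.I * deriv γ s)
    (by rwa [hγ.normalSpeed_I_mul_deriv hs, mul_one])
  filter_upwards [h, hγ.positively_oriented s hs] with u h1 h2
  exact h1.2 h2.1

theorem eventually_notMem (hγ : IsBoundaryParam Ω L γ) (hopen : IsOpen Ω) {s : ℝ}
    (hs : ContDiffAt ℝ 1 γ s) {v : ℂ} (hv : normalSpeed γ v s < 0) :
    ∀ᶠ u : ℝ in 𝓝[>] 0, γ s + u * v ∉ Ω := by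
  have hneg : normalSpeed γ (-(Complex.I * deriv γ s)) s = -1 := by
    rw [normalSpeed, neg_mul, Complex.neg_im]
    exact congrArg _ (hγ.normalSpeed_I_mul_deriv hs)
  have h := hγ.eventually_mem_iff_mem hopen hs (v := v) (w := -(Complex.I * deriv γ s))
    (by rw [hneg]; linarith)
  filter_upwards [h, hγ.positively_oriented s hs] with u h1 h2 h3
  refine h2.2 ?_
  have := h1.1 h3
  rwa [mul_neg, ← sub_eq_add_neg] at this

end IsBoundaryParam

/-! ### Phase points in terms of footpoint and velocity -/

theorem normalSpeed_neg (v : ℂ) (s : ℝ) : normalSpeed γ (-v) s = -normalSpeed γ v s := by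
  simp [normalSpeed]

theorem transverse_add_mul_self (v x : ℂ) (t : ℝ) :
    transverse v (x + t * v) = transverse v x := by
  rw [transverse, add_mul, mul_assoc, Complex.mul_conj, Complex.add_im, ← Complex.ofReal_mul,
    Complex.ofReal_im, add_zero, transverse]

theorem IsBoundaryParam.outVelocity_phasePoint (hγ : IsBoundaryParam Ω L γ) {v : ℂ}
    (hv : ‖v‖ = 1) {s : ℝ} (hs : ContDiffAt ℝ 1 γ s) :
    outVelocity γ (phasePoint γ v s) = v := by
  have hτ := hγ.unit_speed s hs
  have h := Complex.norm_mul_exp_arg_mul_I (v * conj (deriv γ s))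
  rw [norm_mul, RCLike.norm_conj, hv, hτ, mul_one, Complex.ofReal_one, one_mul] at h
  rw [outVelocity, phasePoint, h, mul_left_comm, Complex.mul_conj, Complex.normSq_eq_norm_sq, hτ]
  simp

theorem phasePoint_mem_smoothPhase {v : ℂ} {s : ℝ} (hs : s ∈ Ico 0 L)
    (hs' : ContDiffAt ℝ 1 γ s) (hn : 0 < normalSpeed γ v s) :
    phasePoint γ v s ∈ smoothPhase L γ := by
  have hn' : 0 < (v * conj (deriv γ s)).im := hn
  refine ⟨hs, hs', lt_of_le_of_ne (Complex.arg_nonneg_iff.2 hn'.le) ?_,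
    Complex.arg_lt_pi_iff.2 (Or.inr hn'.ne')⟩
  intro h
  exact hn'.ne' (Complex.arg_eq_zero_iff.1 h.symm).2

theorem IsBoundaryParam.outVelocity_mul_conj_deriv (hγ : IsBoundaryParam Ω L γ) {z : ℝ × ℝ}
    (hz : ContDiffAt ℝ 1 γ z.1) :
    outVelocity γ z * conj (deriv γ z.1) = Complex.exp (z.2 * Complex.I) := by
  rw [outVelocity, mul_right_comm, Complex.mul_conj, Complex.normSq_eq_norm_sq,
    hγ.unit_speed _ hz]
  simp

theorem IsBoundaryParam.normalSpeed_outVelocity (hγ : IsBoundaryParam Ω L γ) {z : ℝ × ℝ}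
    (hz : ContDiffAt ℝ 1 γ z.1) : normalSpeed γ (outVelocity γ z) z.1 = Real.sin z.2 := by
  rw [normalSpeed, hγ.outVelocity_mul_conj_deriv hz, Complex.exp_ofReal_mul_I_im]

theorem IsBoundaryParam.phasePoint_outVelocity (hγ : IsBoundaryParam Ω L γ) {z : ℝ × ℝ}
    (hz : z ∈ smoothPhase L γ) : phasePoint γ (outVelocity γ z) z.1 = z := by
  refine Prod.ext rfl ?_
  have h := hz.2.2
  simp only [phasePoint]
  rw [hγ.outVelocity_mul_conj_deriv hz.2.1, Complex.exp_mul_I, Complex.arg_cos_add_sin_mul_I]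
  exact ⟨by linarith [h.1, Real.pi_pos], h.2.le⟩

/-! ### The ball hits the boundary -/

/-- A ball that starts at a smooth boundary point into the domain, along a line that contains no
vertex and is nowhere tangent to the boundary, has a well defined next collision. -/
theorem IsBoundaryParam.phasePoint_mem_mapDomain (hγ : IsBoundaryParam Ω L γ) (hopen : IsOpen Ω)
    (hbdd : Bornology.IsBounded Ω) {v : ℂ} (hv : ‖v‖ = 1) {s : ℝ} (hs : s ∈ Ico 0 L)
    (hs' : ContDiffAt ℝ 1 γ s) (hn : 0 < normalSpeed γ v s)
    (hreg : ∀ s' ∈ Ico 0 L, transverse v (γ s') = transverse v (γ s) →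
      ContDiffAt ℝ 1 γ s' ∧ normalSpeed γ v s' ≠ 0) :
    phasePoint γ v s ∈ mapDomain Ω L γ := by
  obtain ⟨r, hr, hrΩ⟩ := mem_nhdsGT_iff_exists_Ioo_subset.1 (hγ.eventually_mem hopen hs' hn)
  have hr0 : (0 : ℝ) < r := hr
  obtain ⟨R, hR⟩ := hbdd.exists_norm_le
  -- The starting point is itself outside Ω. The cutoff `r` removes it, so that the infimum of `E`
  -- is a positive first exit time.
  set E := {u : ℝ | r ≤ u ∧ γ s + u * v ∉ Ω} with hE
  have hc : Continuous fun u : ℝ => γ s + u * v := by fun_prop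
  have hEc : IsClosed E := isClosed_Ici.inter (hopen.isClosed_compl.preimage hc)
  have hEb : BddBelow E := ⟨r, fun u hu => hu.1⟩
  have hEn : E.Nonempty := by
    refine ⟨max r (R + ‖γ s‖ + 1), le_max_left _ _, fun h => ?_⟩
    have h1 := hR _ h
    have h2 : max r (R + ‖γ s‖ + 1) ≤ ‖γ s + (max r (R + ‖γ s‖ + 1) : ℝ) * v‖ + ‖γ s‖ := by
      have h3 := norm_sub_le (γ s + (max r (R + ‖γ s‖ + 1) : ℝ) * v) (γ s)
      rwa [add_sub_cancel_left, norm_mul, hv, mul_one,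
        Complex.norm_of_nonneg (hr0.le.trans (le_max_left _ _))] at h3
    linarith [le_max_right r (R + ‖γ s‖ + 1)]
  set t := sInf E with ht
  have htE : t ∈ E := hEc.csInf_mem hEn hEb
  have ht0 : 0 < t := hr0.trans_le htE.1
  have hlt : ∀ u ∈ Ioo 0 t, γ s + u * v ∈ Ω := by
    intro u hu
    by_contra h
    rcases lt_or_ge u r with h1 | h1
    · exact h (hrΩ ⟨hu.1, h1⟩)
    · exact absurd (csInf_le hEb ⟨h1, h⟩) (not_le.2 hu.2)
  have hfr : γ s + t * v ∈ frontier Ω := by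
    rw [hopen.frontier_eq]
    refine ⟨?_, htE.2⟩
    refine mem_closure_of_tendsto (b := 𝓝[<] t) (hc.tendsto t |>.mono_left nhdsWithin_le_nhds) ?_
    filter_upwards [Ioo_mem_nhdsLT ht0] with u hu using hlt u hu
  obtain ⟨s', hs'I, hs'γ⟩ := hγ.exists_mem_Ico hfr
  obtain ⟨hsm, hns⟩ := hreg s' hs'I (by rw [hs'γ, transverse_add_mul_self])
  -- Were the ball moving inwards at the hit, the points just before it would lie outside Ω.
  have hneg : normalSpeed γ v s' < 0 := by
    refine lt_of_le_of_ne (not_lt.1 fun hpos => ?_) hns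
    have h1 := hγ.eventually_notMem hopen hsm (v := -v)
      (by rw [normalSpeed_neg]; linarith)
    obtain ⟨u, hu, hut⟩ := (h1.and (Ioo_mem_nhdsGT ht0)).exists
    refine hu ?_
    have := hlt (t - u) ⟨by linarith [hut.2], by linarith [hut.1]⟩
    rw [hs'γ]
    convert this using 1
    push_cast
    ring
  have hz : phasePoint γ v s ∈ smoothPhase L γ := phasePoint_mem_smoothPhase hs hs' hn
  have hw : phasePoint γ (-v) s' ∈ smoothPhase L γ :=
    phasePoint_mem_smoothPhase hs'I hsm (by rw [normalSpeed_neg]; linarith)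
  have hvz := hγ.outVelocity_phasePoint hv hs'
  have hvw := hγ.outVelocity_phasePoint (v := -v) (by rwa [norm_neg]) hsm
  refine ⟨reversal (phasePoint γ (-v) s'), hz, reversal_mem_smoothPhase hw,
    ⟨t, ht0, ?_, ?_⟩, ?_⟩
  · rw [hvz]
    exact hs'γ
  · rw [hvz]
    exact hlt
  · rw [hvz, inVelocity_reversal, hvw, neg_neg]

/-! ### Parallel lines -/

theorem continuousAt_deriv {s : ℝ} (hs : ContDiffAt ℝ 1 γ s) : ContinuousAt (deriv γ) s := by
  have h : ContinuousAt (fun x => fderiv ℝ γ x 1) s :=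
    (hs.continuousAt_fderiv one_ne_zero).clm_apply continuousAt_const
  exact h

/-- The smooth boundary points at which `v` is transverse to the boundary. -/
def transversePoints (γ : ℝ → ℂ) (v : ℂ) : Set ℝ :=
  {s | ContDiffAt ℝ 1 γ s ∧ normalSpeed γ v s ≠ 0}

theorem isOpen_transversePoints (v : ℂ) : IsOpen (transversePoints γ v) := by
  refine isOpen_iff_mem_nhds.2 fun s hs => ?_
  have h1 : ∀ᶠ s' in 𝓝 s, ContDiffAt ℝ 1 γ s' := isOpen_setOf_contDiffAt.mem_nhds hs.1
  have h2 : ContinuousAt (normalSpeed γ v) s := by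
    have := continuousAt_deriv hs.1
    unfold normalSpeed
    fun_prop
  filter_upwards [h1, h2.eventually_ne hs.2] with s' h3 h4 using ⟨h3, h4⟩

/-- Up to sign the normal speed is the Jacobian of projection along `v`; this turns flux into
length. -/
theorem hasDerivAt_transverse (v : ℂ) {s : ℝ} (hs : ContDiffAt ℝ 1 γ s) :
    HasDerivAt (fun s => transverse v (γ s)) (-normalSpeed γ v s) s := by
  have h1 : HasDerivAt γ (deriv γ s) s := (hs.differentiableAt one_ne_zero).hasDerivAt
  have h2 : HasDerivAt (fun s => γ s * conj v) (deriv γ s * conj v) s := h1.mul_const _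
  have h3 := (Complex.imCLM.hasFDerivAt (x := γ s * conj v)).comp_hasDerivAt s h2
  have h4 : -normalSpeed γ v s = Complex.imCLM (deriv γ s * conj v) := by
    simp only [normalSpeed, Complex.imCLM_apply, Complex.mul_im, Complex.conj_re, Complex.conj_im]
    ring
  rw [h4]
  exact h3

/-- By Rolle, projection along `v` is injective on every interval of transverse points. Rational
intervals cover this open set and are then made disjoint. -/
theorem exists_seq_injOn_transverse (γ : ℝ → ℂ) (v : ℂ) : ∃ V : ℕ → Set ℝ,
    (∀ n, MeasurableSet (V n)) ∧ Pairwise (Function.onFun Disjoint V) ∧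
      (∀ n, InjOn (fun s => transverse v (γ s)) (V n)) ∧ transversePoints γ v ⊆ ⋃ n, V n := by
  classical
  obtain ⟨e, he⟩ := exists_surjective_nat (ℚ × ℚ)
  set W : ℕ → Set ℝ := fun n => if Ioo ((e n).1 : ℝ) (e n).2 ⊆ transversePoints γ v then
    Ioo ((e n).1 : ℝ) (e n).2 else ∅ with hW
  have hWm : ∀ n, MeasurableSet (W n) := fun n => by
    simp only [hW]
    split_ifs
    exacts [measurableSet_Ioo, MeasurableSet.empty]
  have key : ∀ a b c d : ℝ, Ioo a b ⊆ transversePoints γ v → c ∈ Ioo a b → d ∈ Ioo a b → c < d →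
      transverse v (γ c) ≠ transverse v (γ d) := by
    intro a b c d hab hc hd hcd heq
    have hmem : ∀ x ∈ Icc c d, x ∈ transversePoints γ v := fun x hx =>
      hab ⟨hc.1.trans_le hx.1, hx.2.trans_lt hd.2⟩
    obtain ⟨x, hx, hx0⟩ := exists_hasDerivAt_eq_zero hcd
      (fun x hx => (hasDerivAt_transverse v (hmem x hx).1).continuousAt.continuousWithinAt) heq
      (fun x hx => hasDerivAt_transverse v (hmem x (Ioo_subset_Icc_self hx)).1)
    exact (hmem x (Ioo_subset_Icc_self hx)).2 (neg_eq_zero.1 hx0)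
  have hWi : ∀ n, InjOn (fun s => transverse v (γ s)) (W n) := fun n => by
    simp only [hW]
    split_ifs with h
    · intro c hc d hd hcd
      rcases lt_trichotomy c d with hlt | heq | hlt
      · exact absurd hcd (key _ _ c d h hc hd hlt)
      · exact heq
      · exact absurd hcd.symm (key _ _ d c h hd hc hlt)
    · exact injOn_empty _
  refine ⟨disjointed W, fun n => MeasurableSet.disjointed hWm n, disjoint_disjointed W,
    fun n => (hWi n).mono (disjointed_subset W n), fun s hs => ?_⟩
  rw [iUnion_disjointed, mem_iUnion]
  obtain ⟨ε, hε, hεs⟩ := Metric.isOpen_iff.1 (isOpen_transversePoints (γ := γ) v) s hs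
  rw [Real.ball_eq_Ioo] at hεs
  obtain ⟨a, ha, ha'⟩ := exists_rat_btwn (sub_lt_self s hε)
  obtain ⟨b, hb, hb'⟩ := exists_rat_btwn (lt_add_of_pos_right s hε)
  obtain ⟨n, hn⟩ := he (a, b)
  refine ⟨n, ?_⟩
  simp only [hW, hn]
  rw [if_pos (show Ioo (a : ℝ) b ⊆ transversePoints γ v from
    fun x hx => hεs ⟨ha.trans hx.1, hx.2.trans hb'⟩)]
  exact ⟨ha', hb⟩

/-- The flux through the part `A` of the boundary of a parallel stream with velocity `v`. -/
noncomputable def flux (γ : ℝ → ℂ) (v : ℂ) (A : Set ℝ) : ENNReal :=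
  ∫⁻ s in A, ENNReal.ofReal |normalSpeed γ v s|

theorem flux_eq_volume_image {v : ℂ} {A : Set ℝ} (hA : MeasurableSet A)
    (hAt : A ⊆ transversePoints γ v) (hi : InjOn (fun s => transverse v (γ s)) A) :
    flux γ v A = volume ((fun s => transverse v (γ s)) '' A) := by
  have h := lintegral_image_eq_lintegral_abs_deriv_mul hA
    (fun s hs => (hasDerivAt_transverse v (hAt hs).1).hasDerivWithinAt) hi (fun _ => 1)
  simp only [lintegral_const, Measure.restrict_apply MeasurableSet.univ, univ_inter, one_mul,
    mul_one, abs_neg] at h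
  exact h.symm

theorem flux_iUnion {v : ℂ} {A : ℕ → Set ℝ} (hA : ∀ n, MeasurableSet (A n))
    (hd : Pairwise (Function.onFun Disjoint A)) : flux γ v (⋃ n, A n) = ∑' n, flux γ v (A n) :=
  lintegral_iUnion hA hd _

theorem flux_eq_zero_of_volume_image {v : ℂ} {A : Set ℝ} (hA : MeasurableSet A)
    (hAt : A ⊆ transversePoints γ v) (h0 : volume ((fun s => transverse v (γ s)) '' A) = 0) :
    flux γ v A = 0 := by
  obtain ⟨V, hVm, hVd, hVi, hV⟩ := exists_seq_injOn_transverse γ v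
  have hAV : A = ⋃ n, A ∩ V n := by
    rw [← inter_iUnion, inter_eq_left.2 (hAt.trans hV)]
  rw [hAV, flux_iUnion (fun n => hA.inter (hVm n))
    (fun i j hij => (hVd hij).mono inter_subset_right inter_subset_right)]
  refine ENNReal.tsum_eq_zero.2 fun n => ?_
  rw [flux_eq_volume_image (hA.inter (hVm n)) (inter_subset_left.trans hAt)
    ((hVi n).mono inter_subset_right)]
  exact measure_mono_null (image_mono inter_subset_left) h0

/-- A one-to-one correspondence along the lines with direction `v` preserves the flux. -/
theorem flux_image {v : ℂ} {A : Set ℝ} (hA : MeasurableSet A) (hAt : A ⊆ transversePoints γ v)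
    {f : ℝ → ℝ} (hf : Measurable f) (hfi : InjOn f A) (hfA : f '' A ⊆ transversePoints γ v)
    (hft : ∀ s ∈ A, transverse v (γ (f s)) = transverse v (γ s)) :
    flux γ v (f '' A) = flux γ v A := by
  obtain ⟨V, hVm, hVd, hVi, hV⟩ := exists_seq_injOn_transverse γ v
  have hAV : A = ⋃ n, A ∩ V n := by
    rw [← inter_iUnion, inter_eq_left.2 (hAt.trans hV)]
  have hfAV : f '' A = ⋃ n, f '' (A ∩ V n) := by
    rw [← image_iUnion, ← hAV]
  rw [hfAV]
  conv_rhs => rw [hAV]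
  rw [flux_iUnion (fun n => hA.inter (hVm n))
      (fun i j hij => (hVd hij).mono inter_subset_right inter_subset_right),
    flux_iUnion (fun n => (hA.inter (hVm n)).image_of_measurable_injOn hf
      (hfi.mono inter_subset_left))
      (fun i j hij => ?_)]
  -- A piece and its image under `f` project injectively to the same set of lines, so both have that
  -- set's length as flux.
  · refine tsum_congr fun n => ?_
    rw [flux_eq_volume_image (hA.inter (hVm n)) (inter_subset_left.trans hAt)
        ((hVi n).mono inter_subset_right),
      flux_eq_volume_image ((hA.inter (hVm n)).image_of_measurable_injOn hf
        (hfi.mono inter_subset_left)) ((image_mono inter_subset_left).trans hfA) ?_]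
    · congr 1
      rw [image_image]
      exact image_congr fun s hs => hft s hs.1
    · rintro _ ⟨s, hs, rfl⟩ _ ⟨s', hs', rfl⟩ h
      simp only [hft s hs.1, hft s' hs'.1] at h
      rw [hVi n hs.2 hs'.2 h]
  · rw [Function.onFun, disjoint_left]
    rintro _ ⟨s, hs, rfl⟩ ⟨s', hs', h⟩
    have := hfi hs'.1 hs.1 h
    subst this
    exact disjoint_left.1 (hVd hij) hs.2 hs'.2

/-- One-dimensional Sard: almost no line of direction `v` is tangent to a smooth boundary arc. -/
theorem volume_image_transverse_critical (γ : ℝ → ℂ) (v : ℂ) :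
    volume ((fun s => transverse v (γ s)) ''
      {s | ContDiffAt ℝ 1 γ s ∧ normalSpeed γ v s = 0}) = 0 := by
  refine addHaar_image_eq_zero_of_det_fderivWithin_eq_zero volume
    (fun s hs => (hasDerivAt_transverse v hs.1).hasFDerivAt.hasFDerivWithinAt) fun s hs => ?_
  rw [hs.2, neg_zero]
  simp

theorem IsBoundaryParam.finite_not_contDiffAt (hγ : IsBoundaryParam Ω L γ) :
    {s | s ∈ Ico 0 L ∧ ¬ContDiffAt ℝ 1 γ s}.Finite := by
  obtain ⟨vertices, hfin, hsm⟩ := hγ.piecewise_smooth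
  have hsub : {s | s ∈ Ico 0 L ∧ ¬ContDiffAt ℝ 1 γ s} ⊆ Ico 0 L ∩ γ ⁻¹' vertices := by
    rintro s ⟨hs, hns⟩
    refine ⟨hs, ?_⟩
    by_contra hv
    have hnhds : γ ⁻¹' verticesᶜ ∈ 𝓝 s :=
      (hfin.isClosed.isOpen_compl.preimage hγ.continuous).mem_nhds hv
    obtain ⟨ε, hε, hεs⟩ := Metric.mem_nhds_iff.1 hnhds
    rw [Real.ball_eq_Ioo] at hεs
    have h := hsm (s - ε) (s + ε) (by linarith) fun x hx => hεs hx
    exact hns (h.contDiffAt (Icc_mem_nhds (by linarith) (by linarith)))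
  refine Finite.subset ?_ hsub
  refine Finite.of_finite_image (f := γ) (hfin.subset ?_) (hγ.injOn.mono inter_subset_left)
  rintro _ ⟨s, hs, rfl⟩
  exact hs.2

/-- If the next collision is undefined, the line meets a vertex or is tangent somewhere; such lines
have null transverse coordinates. -/
theorem flux_compl_mapDomain (hopen : IsOpen Ω) (hbdd : Bornology.IsBounded Ω)
    (hγ : IsBoundaryParam Ω L γ) {v : ℂ} (hv : ‖v‖ = 1) {A : Set ℝ} (hA : MeasurableSet A)
    (hA' : A ⊆ {s | s ∈ Ico 0 L ∧ ContDiffAt ℝ 1 γ s ∧ 0 < normalSpeed γ v s ∧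
      phasePoint γ v s ∉ mapDomain Ω L γ}) : flux γ v A = 0 := by
  refine flux_eq_zero_of_volume_image hA (fun s hs => ⟨(hA' hs).2.1, (hA' hs).2.2.1.ne'⟩) ?_
  have hnull : volume ((fun s => transverse v (γ s)) ''
      {s | s ∈ Ico 0 L ∧ ¬ContDiffAt ℝ 1 γ s}) = 0 :=
    (hγ.finite_not_contDiffAt.image _).measure_zero _
  refine measure_mono_null ?_ (measure_union_null hnull (volume_image_transverse_critical γ v))
  rintro _ ⟨s, hs, rfl⟩
  obtain ⟨hsI, hsm, hn, hD⟩ := hA' hs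
  by_contra hcon
  refine hD (hγ.phasePoint_mem_mapDomain hopen hbdd hv hsI hsm hn fun s' hs' heq => ?_)
  have h1 : ContDiffAt ℝ 1 γ s' := by
    by_contra h
    exact hcon (Or.inl ⟨s', ⟨hs', h⟩, heq⟩)
  exact ⟨h1, fun h => hcon (Or.inr ⟨s', ⟨h1, h⟩, heq⟩)⟩

/-! ### The Liouville measure as an integral over directions -/

theorem lintegral_comp_add_of_periodic {g : ℝ → ENNReal} (hg : Function.Periodic g (2 * Real.pi))
    (α : ℝ) : ∫⁻ ψ in Ioc (-Real.pi) Real.pi, g (ψ + α) =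
      ∫⁻ ψ in Ioc (-Real.pi) Real.pi, g ψ := by
  have : Fact (0 < 2 * Real.pi) := ⟨Real.two_pi_pos⟩
  have key : ∀ t : ℝ, ∫⁻ ψ in Ioc t (t + 2 * Real.pi), g ψ =
      ∫⁻ b : AddCircle (2 * Real.pi), hg.lift b := fun t => by
    rw [← AddCircle.lintegral_preimage (2 * Real.pi) t]
    simp only [Function.Periodic.lift_coe]
  have h1 := (measurePreserving_add_right volume α).setLIntegral_comp_preimage_emb
    (measurableEmbedding_addRight α) g (Ioc (-Real.pi + α) (-Real.pi + α + 2 * Real.pi))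
  rw [preimage_add_const_Ioc] at h1
  have h2 := key (-Real.pi)
  rw [key, show -Real.pi + α - α = -Real.pi by ring,
    show -Real.pi + α + 2 * Real.pi - α = Real.pi by ring] at h1
  rw [show -Real.pi + 2 * Real.pi = Real.pi by ring] at h2
  rw [h1, h2]

/-- Rotation invariance of the angle integral, used to turn the tangent frame and to exchange `v`
and `-v`. -/
theorem lintegral_exp_mul_of_norm_eq_one (h : ℂ → ENNReal) {c : ℂ} (hc : ‖c‖ = 1) :
    ∫⁻ ψ : ℝ in Ioc (-Real.pi) Real.pi, h (Complex.exp (ψ * Complex.I) * c) =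
      ∫⁻ ψ : ℝ in Ioc (-Real.pi) Real.pi, h (Complex.exp (ψ * Complex.I)) := by
  have hg : Function.Periodic (fun ψ : ℝ => h (Complex.exp (ψ * Complex.I))) (2 * Real.pi) := by
    intro ψ
    simp only
    congr 1
    push_cast
    rw [add_mul]
    exact Complex.exp_periodic _
  rw [← lintegral_comp_add_of_periodic hg (Complex.arg c)]
  have harg := Complex.norm_mul_exp_arg_mul_I c
  rw [hc, Complex.ofReal_one, one_mul] at harg
  simp only [Complex.ofReal_add, add_mul, Complex.exp_add, harg]

theorem liouville_apply_eq_lintegral {B : Set (ℝ × ℝ)} (hB : MeasurableSet B) :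
    liouville L B = ∫⁻ s in Ico 0 L, ∫⁻ θ in Icc 0 Real.pi,
      B.indicator (fun z => ENNReal.ofReal (Real.sin z.2)) (s, θ) := by
  have hm : Measurable (B.indicator fun z : ℝ × ℝ => ENNReal.ofReal (Real.sin z.2)) :=
    Measurable.indicator (by fun_prop) hB
  rw [liouville, withDensity_apply _ hB, ← lintegral_indicator hB, phaseSpace,
    Measure.volume_eq_prod, ← Measure.prod_restrict, lintegral_prod _ hm.aemeasurable]

theorem ae_restrict_contDiffAt (hγ : IsBoundaryParam Ω L γ) :
    ∀ᵐ s ∂volume.restrict (Ico 0 L), ContDiffAt ℝ 1 γ s := by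
  rw [ae_restrict_iff' measurableSet_Ico, ae_iff]
  simp only [Classical.not_imp]
  exact hγ.finite_not_contDiffAt.measure_zero _

/-- The footpoints of the phase points of `B` with outgoing velocity `v`. -/
def directionSlice (L : ℝ) (γ : ℝ → ℂ) (B : Set (ℝ × ℝ)) (v : ℂ) : Set ℝ :=
  {s | s ∈ Ico 0 L ∧ ContDiffAt ℝ 1 γ s ∧ 0 < normalSpeed γ v s ∧ phasePoint γ v s ∈ B}

theorem measurable_normalSpeed (γ : ℝ → ℂ) :
    Measurable fun q : ℂ × ℝ => normalSpeed γ q.1 q.2 := by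
  have h : Measurable fun q : ℂ × ℝ => deriv γ q.2 := (measurable_deriv γ).comp measurable_snd
  exact Complex.measurable_im.comp
    (measurable_fst.mul (Complex.continuous_conj.measurable.comp h))

theorem measurable_phasePoint (γ : ℝ → ℂ) :
    Measurable fun q : ℂ × ℝ => phasePoint γ q.1 q.2 := by
  have h : Measurable fun q : ℂ × ℝ => deriv γ q.2 := (measurable_deriv γ).comp measurable_snd
  exact measurable_snd.prodMk (Complex.measurable_arg.comp
    (measurable_fst.mul (Complex.continuous_conj.measurable.comp h)))

theorem measurableSet_directionSlice {B : Set (ℝ × ℝ)} (hB : MeasurableSet B) (v : ℂ) :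
    MeasurableSet (directionSlice L γ B v) :=
  measurableSet_Ico.inter (isOpen_setOf_contDiffAt.measurableSet.inter
    ((measurableSet_lt measurable_const
      ((measurable_normalSpeed γ).comp measurable_prodMk_left)).inter
      (hB.preimage ((measurable_phasePoint γ).comp measurable_prodMk_left))))

/-- At fixed s, turning θ by the tangent angle makes the absolute direction the variable, with sin θ
equal to the normal speed; outward directions contribute 0. Tonelli then exchanges footpoint and
direction. -/
theorem liouville_apply_eq_lintegral_flux (hγ : IsBoundaryParam Ω L γ) {B : Set (ℝ × ℝ)}
    (hB : MeasurableSet B) :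
    liouville L B = ∫⁻ ψ : ℝ in Ioc (-Real.pi) Real.pi,
      flux γ (Complex.exp (ψ * Complex.I))
        (directionSlice L γ B (Complex.exp (ψ * Complex.I))) := by
  set F : ℂ × ℝ → ENNReal := fun q =>
    ((fun q : ℂ × ℝ => phasePoint γ q.1 q.2) ⁻¹' B).indicator
      (fun q => ENNReal.ofReal (normalSpeed γ q.1 q.2)) q with hF
  have hFm : Measurable F := by
    refine Measurable.indicator ?_ (hB.preimage (measurable_phasePoint γ))
    exact ENNReal.measurable_ofReal.comp (measurable_normalSpeed γ)
  have hexp : Measurable fun ψ : ℝ => Complex.exp (ψ * Complex.I) := by fun_prop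
  have hinner : ∀ s, ContDiffAt ℝ 1 γ s → ∫⁻ θ in Icc 0 Real.pi,
      B.indicator (fun z => ENNReal.ofReal (Real.sin z.2)) (s, θ) =
      ∫⁻ ψ : ℝ in Ioc (-Real.pi) Real.pi, F (Complex.exp (ψ * Complex.I), s) := by
    intro s hs
    set h : ℂ → ENNReal := fun y =>
      B.indicator (fun _ => ENNReal.ofReal y.im) (s, Complex.arg y) with hh
    have hrot := lintegral_exp_mul_of_norm_eq_one h (c := conj (deriv γ s))
      (by rw [RCLike.norm_conj, hγ.unit_speed s hs])
    have hFh : ∀ v : ℂ, F (v, s) = h (v * conj (deriv γ s)) := fun v => by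
      simp only [hF, hh, indicator]
      rfl
    simp only [hFh]
    rw [hrot, ← lintegral_indicator measurableSet_Icc, ← lintegral_indicator measurableSet_Ioc]
    refine lintegral_congr_ae ?_
    have hne : ∀ᵐ θ : ℝ, θ ≠ 0 := Measure.ae_ne volume 0
    filter_upwards [hne] with θ hθ0
    by_cases hθ : θ ∈ Ioc (-Real.pi) Real.pi
    · have harg : Complex.arg (Complex.exp (θ * Complex.I)) = θ := by
        rw [Complex.exp_mul_I, Complex.arg_cos_add_sin_mul_I hθ]
      rw [indicator_of_mem hθ]
      simp only [hh, harg, Complex.exp_ofReal_mul_I_im]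
      by_cases hpos : 0 ≤ θ
      · rw [indicator_of_mem (show θ ∈ Icc 0 Real.pi from ⟨hpos, hθ.2⟩)]
        rfl
      · rw [indicator_of_notMem (fun h : θ ∈ Icc 0 Real.pi => hpos h.1)]
        have : Real.sin θ ≤ 0 :=
          Real.sin_nonpos_of_nonpos_of_neg_pi_le (not_le.1 hpos).le hθ.1.le
        rw [ENNReal.ofReal_of_nonpos this]
        simp
    · rw [indicator_of_notMem hθ, indicator_of_notMem]
      exact fun h => hθ ⟨by linarith [h.1, Real.pi_pos], h.2⟩
  have houter : ∀ v : ℂ, ∫⁻ s in Ico 0 L, F (v, s) = flux γ v (directionSlice L γ B v) := by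
    intro v
    rw [flux, ← lintegral_indicator (measurableSet_directionSlice hB v)]
    rw [← inter_eq_right.2 (show directionSlice L γ B v ⊆ Ico 0 L from fun s hs => hs.1),
      ← indicator_indicator, lintegral_indicator measurableSet_Ico]
    refine lintegral_congr_ae ?_
    filter_upwards [ae_restrict_contDiffAt hγ, ae_restrict_mem measurableSet_Ico] with s hs hsI
    by_cases hmem : s ∈ directionSlice L γ B v
    · rw [indicator_of_mem hmem]
      simp only [hF]
      rw [indicator_of_mem (show (v, s) ∈ (fun q : ℂ × ℝ => phasePoint γ q.1 q.2) ⁻¹' B from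
        hmem.2.2.2), abs_of_pos hmem.2.2.1]
    · rw [indicator_of_notMem hmem]
      simp only [hF]
      refine indicator_apply_eq_zero.2 fun hB' => ENNReal.ofReal_of_nonpos ?_
      by_contra hpos
      exact hmem ⟨hsI, hs, not_le.1 hpos, hB'⟩
  rw [liouville_apply_eq_lintegral hB]
  calc _ = ∫⁻ s in Ico 0 L, ∫⁻ ψ : ℝ in Ioc (-Real.pi) Real.pi,
        F (Complex.exp (ψ * Complex.I), s) := by
        refine lintegral_congr_ae ?_
        filter_upwards [ae_restrict_contDiffAt hγ] with s hs using hinner s hs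
    _ = ∫⁻ ψ : ℝ in Ioc (-Real.pi) Real.pi, ∫⁻ s in Ico 0 L,
        F (Complex.exp (ψ * Complex.I), s) := by
        refine lintegral_lintegral_swap (Measurable.aemeasurable ?_)
        exact hFm.comp ((hexp.comp measurable_snd).prodMk measurable_fst)
    _ = _ := by simp only [houter]

theorem norm_exp_mul_I_eq_one (ψ : ℝ) : ‖Complex.exp (ψ * Complex.I)‖ = 1 :=
  Complex.norm_exp_ofReal_mul_I ψ

theorem liouville_compl_mapDomain (hopen : IsOpen Ω) (hbdd : Bornology.IsBounded Ω)
    (hγ : IsBoundaryParam Ω L γ) : liouville L (mapDomain Ω L γ)ᶜ = 0 := by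
  have hD := (measurableSet_mapDomain hopen hγ).compl
  rw [liouville_apply_eq_lintegral_flux hγ hD]
  refine (lintegral_congr fun ψ => ?_).trans lintegral_zero
  exact flux_compl_mapDomain hopen hbdd hγ (norm_exp_mul_I_eq_one ψ)
    (measurableSet_directionSlice hD _) fun s hs => hs

/-! ### Invariance of the Liouville measure -/

/-- The collision followed by time reversal. -/
noncomputable def returnMap (Ω : Set ℂ) (L : ℝ) (γ : ℝ → ℂ) (z : ℝ × ℝ) : ℝ × ℝ :=
  reversal (billiardMap Ω L γ z)

theorem step_returnMap {z : ℝ × ℝ} (hz : z ∈ mapDomain Ω L γ) :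
    Step Ω L γ (returnMap Ω L γ z) (reversal z) :=
  (step_billiardMap hz).reverse

theorem returnMap_mem_mapDomain {z : ℝ × ℝ} (hz : z ∈ mapDomain Ω L γ) :
    returnMap Ω L γ z ∈ mapDomain Ω L γ :=
  ⟨_, step_returnMap hz⟩

/-- An involution on its domain: this replaces an inverse of the billiard map, and images of sets
become preimages. -/
theorem returnMap_returnMap (hopen : IsOpen Ω) (hγ : IsBoundaryParam Ω L γ) {z : ℝ × ℝ}
    (hz : z ∈ mapDomain Ω L γ) : returnMap Ω L γ (returnMap Ω L γ z) = z := by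
  rw [returnMap, hγ.billiardMap_eq hopen (step_returnMap hz), reversal_reversal]

theorem outVelocity_returnMap {z : ℝ × ℝ} (hz : z ∈ mapDomain Ω L γ) :
    outVelocity γ (returnMap Ω L γ z) = -outVelocity γ z := by
  rw [returnMap, outVelocity_reversal, (step_billiardMap hz).2.2.2]

theorem transverse_returnMap {z : ℝ × ℝ} (hz : z ∈ mapDomain Ω L γ) :
    transverse (outVelocity γ z) (γ (returnMap Ω L γ z).1) =
      transverse (outVelocity γ z) (γ z.1) := by
  obtain ⟨-, -, ⟨t, -, h, -⟩, -⟩ := step_billiardMap hz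
  rw [returnMap, reversal_fst, h, transverse_add_mul_self]

theorem measurable_returnMap (hopen : IsOpen Ω) (hγ : IsBoundaryParam Ω L γ) :
    Measurable (returnMap Ω L γ) :=
  measurable_reversal.comp (measurable_billiardMap hopen hγ)

theorem IsBoundaryParam.mem_directionSlice_iff (hγ : IsBoundaryParam Ω L γ) {B : Set (ℝ × ℝ)}
    (hB : B ⊆ smoothPhase L γ) {v : ℂ} (hv : ‖v‖ = 1) {s : ℝ} :
    s ∈ directionSlice L γ B v ↔ ∃ z ∈ B, outVelocity γ z = v ∧ z.1 = s := by
  constructor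
  · rintro ⟨-, hs, -, hsB⟩
    exact ⟨_, hsB, hγ.outVelocity_phasePoint hv hs, rfl⟩
  · rintro ⟨z, hz, rfl, rfl⟩
    refine ⟨(hB hz).1, (hB hz).2.1, ?_, ?_⟩
    · rw [hγ.normalSpeed_outVelocity (hB hz).2.1]
      exact Real.sin_pos_of_mem_Ioo (hB hz).2.2
    · rwa [hγ.phasePoint_outVelocity (hB hz)]

theorem mapDomain_subset_smoothPhase : mapDomain Ω L γ ⊆ smoothPhase L γ :=
  fun _ ⟨_, h⟩ => h.1

theorem directionSlice_returnMap (hopen : IsOpen Ω) (hγ : IsBoundaryParam Ω L γ)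
    (B : Set (ℝ × ℝ)) {v : ℂ} (hv : ‖v‖ = 1) :
    (fun s => (returnMap Ω L γ (phasePoint γ v s)).1) ''
        directionSlice L γ (B ∩ mapDomain Ω L γ) v =
      directionSlice L γ (returnMap Ω L γ ⁻¹' B ∩ mapDomain Ω L γ) (-v) := by
  ext s'
  rw [hγ.mem_directionSlice_iff (inter_subset_right.trans mapDomain_subset_smoothPhase)
    (by rwa [norm_neg])]
  constructor
  · rintro ⟨s, ⟨-, hs, -, hsB, hsD⟩, rfl⟩
    refine ⟨_, ⟨?_, returnMap_mem_mapDomain hsD⟩, ?_, rfl⟩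
    · rwa [mem_preimage, returnMap_returnMap hopen hγ hsD]
    · rw [outVelocity_returnMap hsD, hγ.outVelocity_phasePoint hv hs]
  · rintro ⟨z, ⟨hzB, hzD⟩, hzv, rfl⟩
    have hD := returnMap_mem_mapDomain hzD
    have hv' : outVelocity γ (returnMap Ω L γ z) = v := by
      rw [outVelocity_returnMap hzD, hzv, neg_neg]
    have hp : phasePoint γ v (returnMap Ω L γ z).1 = returnMap Ω L γ z := by
      rw [← hv', hγ.phasePoint_outVelocity (mapDomain_subset_smoothPhase hD)]
    refine ⟨(returnMap Ω L γ z).1, ?_, ?_⟩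
    · rw [hγ.mem_directionSlice_iff (inter_subset_right.trans mapDomain_subset_smoothPhase) hv]
      exact ⟨_, ⟨hzB, hD⟩, hv', rfl⟩
    · simp only [hp, returnMap_returnMap hopen hγ hzD]

theorem flux_neg (v : ℂ) (A : Set ℝ) : flux γ (-v) A = flux γ v A := by
  simp only [flux, normalSpeed_neg, abs_neg]

theorem flux_directionSlice_returnMap (hopen : IsOpen Ω) (hγ : IsBoundaryParam Ω L γ)
    {B : Set (ℝ × ℝ)} (hB : MeasurableSet B) {v : ℂ} (hv : ‖v‖ = 1) :
    flux γ (-v) (directionSlice L γ (returnMap Ω L γ ⁻¹' B ∩ mapDomain Ω L γ) (-v)) =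
      flux γ v (directionSlice L γ (B ∩ mapDomain Ω L γ) v) := by
  have hD := measurableSet_mapDomain hopen hγ
  rw [flux_neg, ← directionSlice_returnMap hopen hγ B hv]
  refine flux_image (measurableSet_directionSlice (hB.inter hD) v)
    (fun s hs => ⟨hs.2.1, hs.2.2.1.ne'⟩) ?_ ?_ ?_ ?_
  · exact measurable_fst.comp ((measurable_returnMap hopen hγ).comp
      ((measurable_phasePoint γ).comp measurable_prodMk_left))
  · rintro s ⟨-, hs, -, -, hsD⟩ s' ⟨-, hs', -, -, hsD'⟩ h
    have hpp : ∀ s, ContDiffAt ℝ 1 γ s → phasePoint γ v s ∈ mapDomain Ω L γ →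
        phasePoint γ (-v) (returnMap Ω L γ (phasePoint γ v s)).1 =
          returnMap Ω L γ (phasePoint γ v s) := fun s hs hsD => by
      have h1 := hγ.phasePoint_outVelocity
        (mapDomain_subset_smoothPhase (returnMap_mem_mapDomain hsD))
      rwa [outVelocity_returnMap hsD, hγ.outVelocity_phasePoint hv hs] at h1
    have h2 : returnMap Ω L γ (phasePoint γ v s) = returnMap Ω L γ (phasePoint γ v s') := by
      rw [← hpp s hs hsD, ← hpp s' hs' hsD']
      exact congrArg _ h
    have h3 := congrArg (returnMap Ω L γ) h2
    rw [returnMap_returnMap hopen hγ hsD, returnMap_returnMap hopen hγ hsD'] at h3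
    exact congrArg Prod.fst h3
  · rw [directionSlice_returnMap hopen hγ B hv]
    rintro s ⟨-, hs, hn, -⟩
    refine ⟨hs, fun h => ?_⟩
    rw [normalSpeed_neg, h] at hn
    simp at hn
  · rintro s ⟨-, hs, -, -, hsD⟩
    have h := transverse_returnMap hsD
    rwa [hγ.outVelocity_phasePoint hv hs] at h

theorem liouville_preimage_returnMap (hopen : IsOpen Ω) (hγ : IsBoundaryParam Ω L γ)
    {B : Set (ℝ × ℝ)} (hB : MeasurableSet B) :
    liouville L (returnMap Ω L γ ⁻¹' B ∩ mapDomain Ω L γ) =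
      liouville L (B ∩ mapDomain Ω L γ) := by
  have hD := measurableSet_mapDomain hopen hγ
  rw [liouville_apply_eq_lintegral_flux hγ (hB.inter hD), liouville_apply_eq_lintegral_flux hγ
    ((hB.preimage (measurable_returnMap hopen hγ)).inter hD)]
  -- Slices of the preimage are matched at -v with slices of `B` at v, so one integral is turned by
  -- π.
  rw [← lintegral_exp_mul_of_norm_eq_one (fun v => flux γ v (directionSlice L γ
    (returnMap Ω L γ ⁻¹' B ∩ mapDomain Ω L γ) v)) (c := -1) (by simp)]
  refine lintegral_congr fun ψ => ?_
  simp only [mul_neg, mul_one]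
  exact flux_directionSlice_returnMap hopen hγ hB (norm_exp_mul_I_eq_one ψ)

theorem measurePreserving_reversal (L : ℝ) :
    MeasurePreserving reversal (liouville L) (liouville L) := by
  refine ⟨measurable_reversal, Measure.ext fun B hB => ?_⟩
  rw [Measure.map_apply measurable_reversal hB, liouville_apply_eq_lintegral hB,
    liouville_apply_eq_lintegral (hB.preimage measurable_reversal)]
  refine lintegral_congr fun s => ?_
  rw [← lintegral_indicator measurableSet_Icc, ← lintegral_indicator measurableSet_Icc,
    ← lintegral_sub_left_eq_self _ Real.pi]
  refine lintegral_congr fun θ => ?_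
  have h1 : Real.pi - θ ∈ Icc 0 Real.pi ↔ θ ∈ Icc 0 Real.pi := by
    simp only [mem_Icc, sub_nonneg, sub_le_self_iff, and_comm]
  have h2 : (s, Real.pi - θ) ∈ reversal ⁻¹' B ↔ (s, θ) ∈ B := by
    simp [reversal]
  have h3 : (reversal ⁻¹' B).indicator (fun z => ENNReal.ofReal (Real.sin z.2)) (s, Real.pi - θ) =
      B.indicator (fun z => ENNReal.ofReal (Real.sin z.2)) (s, θ) := by
    by_cases h : (s, θ) ∈ B
    · rw [indicator_of_mem (h2.2 h), indicator_of_mem h, Real.sin_pi_sub]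
    · rw [indicator_of_notMem (mt h2.1 h), indicator_of_notMem h]
  by_cases hθ : θ ∈ Icc 0 Real.pi
  · rw [indicator_of_mem (h1.2 hθ), indicator_of_mem hθ, h3]
  · rw [indicator_of_notMem (mt h1.1 hθ), indicator_of_notMem hθ]

theorem ae_mem_mapDomain (hopen : IsOpen Ω) (hbdd : Bornology.IsBounded Ω)
    (hγ : IsBoundaryParam Ω L γ) : ∀ᵐ z ∂liouville L, z ∈ mapDomain Ω L γ :=
  mem_ae_iff.2 (liouville_compl_mapDomain hopen hbdd hγ)

/-- The billiard map preserves the Liouville measure. -/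
theorem measurePreserving_billiardMap (hopen : IsOpen Ω) (hbdd : Bornology.IsBounded Ω)
    (hγ : IsBoundaryParam Ω L γ) :
    MeasurePreserving (billiardMap Ω L γ) (liouville L) (liouville L) := by
  have hm := measurable_billiardMap hopen hγ
  refine ⟨hm, Measure.ext fun B hB => ?_⟩
  have hD : ∀ A : Set (ℝ × ℝ), liouville L (A ∩ mapDomain Ω L γ) = liouville L A := fun A =>
    measure_inter_conull (liouville_compl_mapDomain hopen hbdd hγ)
  -- The billiard map is `reversal` after `returnMap`, two maps that preserve ν (the second on its
  -- conull domain).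
  have hpre : billiardMap Ω L γ ⁻¹' B = returnMap Ω L γ ⁻¹' (reversal ⁻¹' B) := by
    ext z
    simp only [mem_preimage, returnMap, reversal_reversal]
  rw [Measure.map_apply hm hB, ← hD, hpre,
    liouville_preimage_returnMap hopen hγ (hB.preimage measurable_reversal), hD,
    (measurePreserving_reversal L).measure_preimage hB.nullMeasurableSet]

/-! ### The footpoint increment -/

theorem increment_mem_Icc {s₁ s₂ : ℝ} (h₁ : s₁ ∈ Ico 0 L) (h₂ : s₂ ∈ Ico 0 L) :
    increment L s₁ s₂ ∈ Icc 0 L := by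
  unfold increment
  split_ifs with h
  · exact ⟨by linarith, by linarith [h₁.1, h₂.2]⟩
  · exact ⟨by linarith [h₁.2, h₂.1], by linarith⟩

/-- The two increments are complementary arcs. For equal footpoints both are 0 and the identity
fails. -/
theorem increment_swap {s₁ s₂ : ℝ} (h : s₁ ≠ s₂) :
    increment L s₂ s₁ = L - increment L s₁ s₂ := by
  unfold increment
  rcases lt_or_gt_of_ne h with h | h
  · rw [if_neg (not_le.2 h), if_pos h.le]
    ring
  · rw [if_pos h.le, if_neg (not_le.2 h)]
    ring

theorem footpointIncrement_mem_Icc (hγ : IsBoundaryParam Ω L γ) (z : ℝ × ℝ) :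
    footpointIncrement Ω L γ z ∈ Icc 0 L := by
  by_cases hz : z ∈ mapDomain Ω L γ
  · have h := step_billiardMap hz
    exact increment_mem_Icc h.1.1 h.2.1.1
  · rw [footpointIncrement, billiardMap_of_notMem hz, increment, if_pos le_rfl, sub_self]
    exact ⟨le_rfl, hγ.perimeter_pos.le⟩

theorem abs_footpointIncrement_le (hγ : IsBoundaryParam Ω L γ) (z : ℝ × ℝ) :
    |footpointIncrement Ω L γ z| ≤ L := by
  have h := footpointIncrement_mem_Icc hγ z
  rw [abs_of_nonneg h.1]
  exact h.2

theorem measurable_footpointIncrement (hopen : IsOpen Ω) (hγ : IsBoundaryParam Ω L γ) :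
    Measurable (footpointIncrement Ω L γ) := by
  have h : Measurable fun z => (billiardMap Ω L γ z).1 :=
    measurable_fst.comp (measurable_billiardMap hopen hγ)
  unfold footpointIncrement increment
  exact Measurable.ite (measurableSet_le measurable_fst h) (h.sub measurable_fst)
    ((h.add_const L).sub measurable_fst)

theorem measurable_averageIncrement (hopen : IsOpen Ω) (hγ : IsBoundaryParam Ω L γ) (n : ℕ) :
    Measurable fun z => averageIncrement Ω L γ z n :=
  (measurable_birkhoffSum (measurable_billiardMap hopen hγ)
    (measurable_footpointIncrement hopen hγ) n).div_const _

theorem averageIncrement_mem_Icc (hγ : IsBoundaryParam Ω L γ) (z : ℝ × ℝ) (n : ℕ) :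
    averageIncrement Ω L γ z n ∈ Icc 0 L := by
  refine ⟨div_nonneg (Finset.sum_nonneg fun k _ => (footpointIncrement_mem_Icc hγ _).1)
    (Nat.cast_nonneg n), ?_⟩
  exact (abs_le.1 (abs_birkhoffAverage_le (abs_footpointIncrement_le hγ) n z)).2

theorem footpointIncrement_reversal_billiardMap (hopen : IsOpen Ω) (hγ : IsBoundaryParam Ω L γ)
    {z : ℝ × ℝ} (hz : z ∈ mapDomain Ω L γ) :
    footpointIncrement Ω L γ (reversal (billiardMap Ω L γ z)) =
      L - footpointIncrement Ω L γ z := by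
  have h := step_billiardMap hz
  rw [footpointIncrement, hγ.billiardMap_eq hopen h.reverse]
  refine increment_swap fun heq => ?_
  exact ((step_iff hγ).1 h).2.2.1 (congrArg γ heq)

theorem iterate_reversal_iterate (hopen : IsOpen Ω) (hγ : IsBoundaryParam Ω L γ) {z : ℝ × ℝ}
    (hz : ∀ k : ℕ, (billiardMap Ω L γ)^[k] z ∈ mapDomain Ω L γ) (n k : ℕ) :
    (billiardMap Ω L γ)^[k] (reversal ((billiardMap Ω L γ)^[n + k] z)) =
      reversal ((billiardMap Ω L γ)^[n] z) := by
  induction k with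
  | zero => rfl
  | succ k ih =>
    rw [Function.iterate_succ_apply, ← add_assoc, Function.iterate_succ_apply',
      hγ.billiardMap_eq hopen (step_billiardMap (hz (n + k))).reverse, ih]

/-- The reversed orbit visits the same chords in opposite order, each contributing the complementary
arc. For n = 0 both averages are 0 by division by zero, hence the exclusion. -/
theorem averageIncrement_reversal_iterate (hopen : IsOpen Ω) (hγ : IsBoundaryParam Ω L γ)
    {z : ℝ × ℝ} (hz : ∀ k : ℕ, (billiardMap Ω L γ)^[k] z ∈ mapDomain Ω L γ) {n : ℕ}
    (hn : n ≠ 0) :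
    averageIncrement Ω L γ (reversal ((billiardMap Ω L γ)^[n] z)) n =
      L - averageIncrement Ω L γ z n := by
  have hterm : ∀ k ∈ Finset.range n,
      footpointIncrement Ω L γ ((billiardMap Ω L γ)^[k] (reversal ((billiardMap Ω L γ)^[n] z))) =
        L - footpointIncrement Ω L γ ((billiardMap Ω L γ)^[n - 1 - k] z) := by
    intro k hk
    have hk' := Finset.mem_range.1 hk
    -- The k-th backward flight retraces the forward flight with index m = n - 1 - k.
    obtain ⟨m, rfl⟩ : ∃ m, n = m + 1 + k := ⟨n - 1 - k, by omega⟩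
    rw [iterate_reversal_iterate hopen hγ hz (m + 1) k, Function.iterate_succ_apply',
      footpointIncrement_reversal_billiardMap hopen hγ (hz m),
      show m + 1 + k - 1 - k = m by omega]
  have hn' : (n : ℝ) ≠ 0 := Nat.cast_ne_zero.2 hn
  rw [averageIncrement, averageIncrement, Finset.sum_congr rfl hterm, Finset.sum_sub_distrib,
    Finset.sum_range_reflect (fun k => footpointIncrement Ω L γ ((billiardMap Ω L γ)^[k] z)),
    Finset.sum_const, Finset.card_range, nsmul_eq_mul, sub_div, mul_div_cancel_left₀ _ hn']

/-! ### The rotation number -/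

theorem liouville_le (L : ℝ) : liouville L ≤ volume.restrict (phaseSpace L) := by
  have h := withDensity_mono (μ := volume.restrict (phaseSpace L))
    (f := fun z : ℝ × ℝ => ENNReal.ofReal (Real.sin z.2)) (g := 1)
    (Eventually.of_forall fun z => ENNReal.ofReal_le_one.2 (Real.sin_le_one _))
  rwa [withDensity_one] at h

instance isFiniteMeasure_liouville (L : ℝ) : IsFiniteMeasure (liouville L) := by
  refine ⟨(liouville_le L univ).trans_lt ?_⟩
  rw [Measure.restrict_apply_univ, phaseSpace, Measure.volume_eq_prod, Measure.prod_prod,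
    Real.volume_Ico, Real.volume_Icc]
  exact ENNReal.mul_lt_top ENNReal.ofReal_lt_top ENNReal.ofReal_lt_top

theorem measurableSet_phaseSpace (L : ℝ) : MeasurableSet (phaseSpace L) :=
  measurableSet_Ico.prod measurableSet_Icc

theorem liouville_restrict_phaseSpace (L : ℝ) :
    (liouville L).restrict (phaseSpace L) = liouville L := by
  refine Measure.restrict_eq_self_of_ae_mem ?_
  exact (Measure.absolutelyContinuous_of_le (liouville_le L)).ae_le
    (ae_restrict_mem (measurableSet_phaseSpace L))

theorem liouville_phaseSpace_ne_zero (hL : 0 < L) : liouville L (phaseSpace L) ≠ 0 := by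
  intro h
  rw [liouville, withDensity_apply_eq_zero (by fun_prop)] at h
  have hsub : Ioo 0 L ×ˢ Ioo 0 Real.pi ⊆
      {z : ℝ × ℝ | ENNReal.ofReal (Real.sin z.2) ≠ 0} ∩ phaseSpace L := by
    rintro z ⟨h1, h2⟩
    refine ⟨?_, Ioo_subset_Ico_self h1, Ioo_subset_Icc_self h2⟩
    exact (ENNReal.ofReal_pos.2 (Real.sin_pos_of_mem_Ioo h2)).ne'
  have h0 := measure_mono_null hsub h
  rw [Measure.restrict_apply (measurableSet_Ioo.prod measurableSet_Ioo), inter_eq_left.2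
    (hsub.trans inter_subset_right), Measure.volume_eq_prod, Measure.prod_prod, Real.volume_Ioo,
    Real.volume_Ioo, mul_eq_zero, ENNReal.ofReal_eq_zero, ENNReal.ofReal_eq_zero] at h0
  rcases h0 with h0 | h0 <;> linarith [Real.pi_pos]

theorem ae_forall_iterate_mem_mapDomain (hopen : IsOpen Ω) (hbdd : Bornology.IsBounded Ω)
    (hγ : IsBoundaryParam Ω L γ) :
    ∀ᵐ z ∂liouville L, ∀ k : ℕ, (billiardMap Ω L γ)^[k] z ∈ mapDomain Ω L γ := by
  refine ae_all_iff.2 fun k => ?_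
  exact ((measurePreserving_billiardMap hopen hbdd hγ).iterate k).quasiMeasurePreserving.ae
    (ae_mem_mapDomain hopen hbdd hγ)

theorem ae_mem_rotationDomain (hopen : IsOpen Ω) (hbdd : Bornology.IsBounded Ω)
    (hγ : IsBoundaryParam Ω L γ) : ∀ᵐ z ∂liouville L, z ∈ rotationDomain Ω L γ := by
  filter_upwards [ae_forall_iterate_mem_mapDomain hopen hbdd hγ,
    ae_exists_tendsto_birkhoffAverage (measurePreserving_billiardMap hopen hbdd hγ)
      (measurable_footpointIncrement hopen hγ) (abs_footpointIncrement_le hγ)] with z h1 h2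
  exact ⟨h1, h2⟩

theorem tendsto_footpointGain {z : ℝ × ℝ} (hz : z ∈ rotationDomain Ω L γ) :
    Tendsto (averageIncrement Ω L γ z) atTop (𝓝 (footpointGain Ω L γ z)) :=
  tendsto_nhds_limUnder hz.2

/-- `limUnder` of measurable functions is measurable even with its default values where no limit
exists. -/
theorem measurable_footpointGain (hopen : IsOpen Ω) (hγ : IsBoundaryParam Ω L γ) :
    Measurable (footpointGain Ω L γ) :=
  (StronglyMeasurable.limUnder (l := atTop) fun n =>
    (measurable_averageIncrement hopen hγ n).stronglyMeasurable).measurable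

theorem measurable_rotationNumber (hopen : IsOpen Ω) (hγ : IsBoundaryParam Ω L γ) :
    Measurable (rotationNumber Ω L γ) :=
  (measurable_footpointGain hopen hγ).div_const L

theorem measurableSet_rotationDomain (hopen : IsOpen Ω) (hγ : IsBoundaryParam Ω L γ) :
    MeasurableSet (rotationDomain Ω L γ) := by
  have h : rotationDomain Ω L γ =
      (⋂ k : ℕ, (billiardMap Ω L γ)^[k] ⁻¹' mapDomain Ω L γ) ∩
        {z | ∃ υ : ℝ, Tendsto (averageIncrement Ω L γ z) atTop (𝓝 υ)} := by
    ext z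
    rw [mem_inter_iff, mem_iInter]
    rfl
  rw [h]
  exact (MeasurableSet.iInter fun k => (measurableSet_mapDomain hopen hγ).preimage
    ((measurable_billiardMap hopen hγ).iterate k)).inter
      (measurableSet_exists_tendsto fun n => measurable_averageIncrement hopen hγ n)

theorem measurableSet_rotationPreimage (hopen : IsOpen Ω) (hγ : IsBoundaryParam Ω L γ)
    {X : Set ℝ} (hX : MeasurableSet X) : MeasurableSet (rotationPreimage Ω L γ X) :=
  (measurableSet_rotationDomain hopen hγ).inter (hX.preimage (measurable_rotationNumber hopen hγ))

theorem rotationNumber_mem_Icc (hγ : IsBoundaryParam Ω L γ) {z : ℝ × ℝ}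
    (hz : z ∈ rotationDomain Ω L γ) : rotationNumber Ω L γ z ∈ Icc 0 1 := by
  have h : footpointGain Ω L γ z ∈ Icc 0 L := isClosed_Icc.mem_of_tendsto
    (tendsto_footpointGain hz) (Eventually.of_forall (averageIncrement_mem_Icc hγ z))
  exact ⟨div_nonneg h.1 hγ.perimeter_pos.le, (div_le_one hγ.perimeter_pos).2 h.2⟩

/-- The distribution of the footpoint gain is symmetric. -/
theorem map_footpointGain (hopen : IsOpen Ω) (hbdd : Bornology.IsBounded Ω)
    (hγ : IsBoundaryParam Ω L γ) :
    (liouville L).map (footpointGain Ω L γ) =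
      (liouville L).map fun z => L - footpointGain Ω L γ z := by
  have hm := measurable_footpointGain hopen hγ
  have hm' : Measurable fun z => L - footpointGain Ω L γ z := hm.const_sub L
  have hAm := measurable_averageIncrement hopen hγ
  have hae := ae_mem_rotationDomain hopen hbdd hγ
  -- The reversing map depends on n, so only laws can be compared. Testing against bounded
  -- continuous functions lets dominated convergence carry the comparison to the limit.
  refine ext_of_forall_integral_eq_of_IsFiniteMeasure fun g => ?_
  rw [integral_map hm.aemeasurable g.continuous.aestronglyMeasurable,
    integral_map hm'.aemeasurable g.continuous.aestronglyMeasurable]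
  have hlim1 : Tendsto (fun n => ∫ z, g (averageIncrement Ω L γ z n) ∂liouville L) atTop
      (𝓝 (∫ z, g (footpointGain Ω L γ z) ∂liouville L)) := by
    refine tendsto_integral_of_dominated_convergence (fun _ => ‖g‖)
      (fun n => (g.continuous.measurable.comp (hAm n)).aestronglyMeasurable) (integrable_const _)
      (fun n => Eventually.of_forall fun z => g.norm_coe_le_norm _) ?_
    filter_upwards [hae] with z hz
    exact (g.continuous.tendsto _).comp (tendsto_footpointGain hz)
  have hlim2 : Tendsto (fun n => ∫ z, g (L - averageIncrement Ω L γ z n) ∂liouville L) atTop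
      (𝓝 (∫ z, g (L - footpointGain Ω L γ z) ∂liouville L)) := by
    refine tendsto_integral_of_dominated_convergence (fun _ => ‖g‖)
      (fun n => (g.continuous.measurable.comp ((hAm n).const_sub L)).aestronglyMeasurable)
      (integrable_const _) (fun n => Eventually.of_forall fun z => g.norm_coe_le_norm _) ?_
    filter_upwards [hae] with z hz
    exact (g.continuous.tendsto _).comp ((tendsto_footpointGain hz).const_sub L)
  refine tendsto_nhds_unique hlim1 (hlim2.congr' ?_)
  filter_upwards [eventually_ne_atTop 0] with n hn
  have hmp : MeasurePreserving (fun z => reversal ((billiardMap Ω L γ)^[n] z)) (liouville L)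
      (liouville L) := (measurePreserving_reversal L).comp
    ((measurePreserving_billiardMap hopen hbdd hγ).iterate n)
  have hcomp : ∫ z, g (averageIncrement Ω L γ (reversal ((billiardMap Ω L γ)^[n] z)) n)
      ∂liouville L = ∫ z, g (averageIncrement Ω L γ z n) ∂liouville L := by
    have h := integral_map (μ := liouville L) hmp.measurable.aemeasurable
      (f := fun z => g (averageIncrement Ω L γ z n))
      (g.continuous.measurable.comp (hAm n)).aestronglyMeasurable
    rw [hmp.map_eq] at h
    exact h.symm
  rw [← hcomp]
  refine integral_congr_ae ?_
  filter_upwards [hae] with z hz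
  rw [averageIncrement_reversal_iterate hopen hγ hz.1 hn]

/-- The distribution of the rotation number is symmetric. -/
theorem map_rotationNumber (hopen : IsOpen Ω) (hbdd : Bornology.IsBounded Ω)
    (hγ : IsBoundaryParam Ω L γ) :
    (liouville L).map (rotationNumber Ω L γ) =
      (liouville L).map fun z => 1 - rotationNumber Ω L γ z := by
  have hm := measurable_footpointGain hopen hγ
  have hdiv : Measurable fun x : ℝ => x / L := measurable_id.div_const L
  have h := congrArg (Measure.map fun x : ℝ => x / L) (map_footpointGain hopen hbdd hγ)
  rw [Measure.map_map hdiv hm, Measure.map_map hdiv (hm.const_sub L)] at h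
  have hsub : (fun z => 1 - rotationNumber Ω L γ z) =
      (fun x : ℝ => x / L) ∘ fun z => L - footpointGain Ω L γ z := by
    funext z
    simp only [Function.comp, rotationNumber, sub_div, div_self hγ.perimeter_pos.ne']
  rw [hsub]
  exact h

theorem liouville_rotationPreimage (hopen : IsOpen Ω) (hbdd : Bornology.IsBounded Ω)
    (hγ : IsBoundaryParam Ω L γ) (X : Set ℝ) :
    liouville L (rotationPreimage Ω L γ X) = liouville L (rotationNumber Ω L γ ⁻¹' X) := by
  have h : rotationPreimage Ω L γ X = rotationNumber Ω L γ ⁻¹' X ∩ rotationDomain Ω L γ :=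
    inter_comm _ _
  rw [h]
  exact measure_inter_conull (mem_ae_iff.1 (ae_mem_rotationDomain hopen hbdd hγ))

theorem image_one_sub (X : Set ℝ) : (fun x => 1 - x) '' X = (fun x => 1 - x) ⁻¹' X :=
  congrFun (image_eq_preimage_of_inverse (g := fun x : ℝ => 1 - x) (fun x => sub_sub_cancel 1 x)
    fun x => sub_sub_cancel 1 x) X

theorem liouville_rotationPreimage_one_sub (hopen : IsOpen Ω) (hbdd : Bornology.IsBounded Ω)
    (hγ : IsBoundaryParam Ω L γ) {X : Set ℝ} (hX : MeasurableSet X) :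
    liouville L (rotationPreimage Ω L γ X) =
      liouville L (rotationPreimage Ω L γ ((fun x => 1 - x) '' X)) := by
  have hm := measurable_rotationNumber hopen hγ
  rw [liouville_rotationPreimage hopen hbdd hγ, liouville_rotationPreimage hopen hbdd hγ,
    ← Measure.map_apply hm hX, map_rotationNumber hopen hbdd hγ,
    Measure.map_apply (hm.const_sub 1) hX, image_one_sub]
  rfl

theorem integrable_rotationNumber (hopen : IsOpen Ω) (hbdd : Bornology.IsBounded Ω)
    (hγ : IsBoundaryParam Ω L γ) : Integrable (rotationNumber Ω L γ) (liouville L) := by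
  refine Integrable.of_bound (measurable_rotationNumber hopen hγ).aestronglyMeasurable 1 ?_
  filter_upwards [ae_mem_rotationDomain hopen hbdd hγ] with z hz
  have h := rotationNumber_mem_Icc hγ hz
  rw [Real.norm_of_nonneg h.1]
  exact h.2

/-- Equal laws give ∫ ρ = ∫ (1 - ρ). -/
theorem integral_rotationNumber (hopen : IsOpen Ω) (hbdd : Bornology.IsBounded Ω)
    (hγ : IsBoundaryParam Ω L γ) :
    ∫ z, rotationNumber Ω L γ z ∂liouville L = 1 / 2 * (liouville L).real univ := by
  have hm := measurable_rotationNumber hopen hγ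
  have h1 := integral_map (μ := liouville L) hm.aemeasurable
    (f := fun x : ℝ => x) measurable_id.aestronglyMeasurable
  have h2 := integral_map (μ := liouville L) (hm.const_sub 1).aemeasurable
    (f := fun x : ℝ => x) measurable_id.aestronglyMeasurable
  rw [map_rotationNumber hopen hbdd hγ, h2,
    integral_sub (integrable_const _) (integrable_rotationNumber hopen hbdd hγ)] at h1
  simp only [integral_const, smul_eq_mul, mul_one] at h1
  linarith

/-- Having a rotation number in `X` is invariant under the billiard map. -/
theorem preimage_rotationPreimage (hγ : IsBoundaryParam Ω L γ) (X : Set ℝ) :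
    billiardMap Ω L γ ⁻¹' rotationPreimage Ω L γ X = rotationPreimage Ω L γ X := by
  have hsub : ∀ z, Tendsto (fun n => averageIncrement Ω L γ (billiardMap Ω L γ z) n -
      averageIncrement Ω L γ z n) atTop (𝓝 0) := fun z =>
    tendsto_birkhoffAverage_sub (abs_footpointIncrement_le hγ) z
  have hiff : ∀ z c, Tendsto (averageIncrement Ω L γ (billiardMap Ω L γ z)) atTop (𝓝 c) ↔
      Tendsto (averageIncrement Ω L γ z) atTop (𝓝 c) := by
    intro z c
    constructor <;> intro h
    · simpa using h.sub (hsub z)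
    · simpa using h.add (hsub z)
  have hdom : ∀ z, billiardMap Ω L γ z ∈ rotationDomain Ω L γ ↔ z ∈ rotationDomain Ω L γ := by
    intro z
    refine and_congr ⟨fun h k => ?_, fun h k => h (k + 1)⟩
      (exists_congr fun c => hiff z c)
    cases k with
    | zero =>
      -- A point outside the domain is fixed by the extended map, so its image would be outside as
      -- well.
      by_contra hz
      have h0 := h 0
      simp only [Function.iterate_zero, id] at h0 hz
      rw [billiardMap_of_notMem hz] at h0
      exact hz h0
    | succ k => exact h k
  ext z
  rw [mem_preimage]
  refine (and_congr_left fun _ => hdom z).trans (and_congr_right fun hz => ?_)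
  have heq : footpointGain Ω L γ (billiardMap Ω L γ z) = footpointGain Ω L γ z :=
    ((hiff z _).2 (tendsto_footpointGain hz)).limUnder_eq
  rw [rotationNumber, heq, rotationNumber]

theorem ae_rotationNumber_eq_half (hopen : IsOpen Ω) (hbdd : Bornology.IsBounded Ω)
    (hγ : IsBoundaryParam Ω L γ) (herg : IsErgodicBilliard Ω L γ) :
    ∀ᵐ z ∂liouville L, rotationNumber Ω L γ z = 1 / 2 := by
  have hconst : ∀ {X : Set ℝ}, MeasurableSet X →
      liouville L (rotationPreimage Ω L γ X) = 0 ∨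
        ∀ᵐ z ∂liouville L, z ∈ rotationPreimage Ω L γ X := by
    intro X hX
    rcases eventuallyConst_set.1 (herg.aeconst_set (measurableSet_rotationPreimage hopen hγ hX)
      (preimage_rotationPreimage hγ X)) with h | h
    · exact Or.inr h
    · exact Or.inl (measure_eq_zero_iff_ae_notMem.2 h)
  have himage : (fun x : ℝ => 1 - x) '' Iio (1 / 2) = Ioi (1 / 2) := by
    rw [image_one_sub]
    ext x
    simp only [mem_preimage, mem_Iio, mem_Ioi]
    constructor <;> intro h <;> linarith
  have hsymm := liouville_rotationPreimage_one_sub hopen hbdd hγ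
    (measurableSet_Iio (a := (1 / 2 : ℝ)))
  rw [himage] at hsymm
  -- If {ρ < 1/2} is null, so is its mirror image {ρ > 1/2}. If it is conull, the mirror image can
  -- be neither null, by equality of measures, nor conull, by disjointness, unless ν = 0, when the
  -- claim is empty.
  rcases hconst (measurableSet_Iio (a := (1 / 2 : ℝ))) with hlt | hlt
  · rw [hlt] at hsymm
    filter_upwards [ae_mem_rotationDomain hopen hbdd hγ, measure_eq_zero_iff_ae_notMem.1 hlt,
      measure_eq_zero_iff_ae_notMem.1 hsymm.symm] with z hz h1 h2
    exact le_antisymm (not_lt.1 fun h => h2 ⟨hz, h⟩) (not_lt.1 fun h => h1 ⟨hz, h⟩)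
  · rcases hconst (measurableSet_Ioi (a := (1 / 2 : ℝ))) with hgt | hgt
    · rw [hgt] at hsymm
      filter_upwards [hlt, measure_eq_zero_iff_ae_notMem.1 hsymm] with z h1 h2
      exact absurd h1 h2
    · filter_upwards [hlt, hgt] with z h1 h2
      exact absurd (mem_Iio.1 h1.2) (lt_asymm (mem_Ioi.1 h2.2))

end PlanarBilliard

/-! ### Assembly of the main theorem -/

theorem mainTheorem1 (Ω : Set ℂ) (L : ℝ) (γ : ℝ → ℂ)
    (hopen : IsOpen Ω) (hbdd : Bornology.IsBounded Ω) (hconn : IsConnected Ω)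
    (hsimply : IsSimplyConnected Ω)
    (hγ : PlanarBilliard.IsBoundaryParam Ω L γ) :
    -- the rotation number exists almost everywhere
    (∀ᵐ z ∂(PlanarBilliard.liouville L), z ∈ PlanarBilliard.rotationDomain Ω L γ) ∧
    -- 1.
    (∀ X : Set ℝ, X ⊆ Set.Icc 0 1 → MeasurableSet X →
      MeasurableSet (PlanarBilliard.rotationPreimage Ω L γ X) ∧
      MeasurableSet (PlanarBilliard.rotationPreimage Ω L γ ((fun x => 1 - x) '' X)) ∧
      PlanarBilliard.liouville L (PlanarBilliard.rotationPreimage Ω L γ X) =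
        PlanarBilliard.liouville L
          (PlanarBilliard.rotationPreimage Ω L γ ((fun x => 1 - x) '' X))) ∧
    -- 2.
    (MeasureTheory.IntegrableOn (PlanarBilliard.rotationNumber Ω L γ)
        (PlanarBilliard.phaseSpace L) (PlanarBilliard.liouville L) ∧
      (∫ z in PlanarBilliard.phaseSpace L, PlanarBilliard.rotationNumber Ω L γ z
          ∂(PlanarBilliard.liouville L)) /
        (PlanarBilliard.liouville L).real (PlanarBilliard.phaseSpace L) = 1 / 2) ∧
    -- 3.
    (PlanarBilliard.IsErgodicBilliard Ω L γ →
      ∀ᵐ z ∂(PlanarBilliard.liouville L), PlanarBilliard.rotationNumber Ω L γ z = 1 / 2) := by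

  have hm := PlanarBilliard.liouville_restrict_phaseSpace L
  have hreal : (PlanarBilliard.liouville L).real Set.univ =
      (PlanarBilliard.liouville L).real (PlanarBilliard.phaseSpace L) := by
    conv_lhs => rw [← hm]
    rw [MeasureTheory.measureReal_restrict_apply_univ]
  refine ⟨PlanarBilliard.ae_mem_rotationDomain hopen hbdd hγ, fun X _ hX => ⟨?_, ?_, ?_⟩,
    ⟨?_, ?_⟩, PlanarBilliard.ae_rotationNumber_eq_half hopen hbdd hγ⟩
  · exact PlanarBilliard.measurableSet_rotationPreimage hopen hγ hX
  · refine PlanarBilliard.measurableSet_rotationPreimage hopen hγ ?_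
    rw [PlanarBilliard.image_one_sub]
    exact hX.preimage (measurable_const.sub measurable_id)
  · exact PlanarBilliard.liouville_rotationPreimage_one_sub hopen hbdd hγ hX
  · exact (PlanarBilliard.integrable_rotationNumber hopen hbdd hγ).integrableOn
  · rw [hm, PlanarBilliard.integral_rotationNumber hopen hbdd hγ, hreal]
    -- The quotient needs ν(Φ) ≠ 0, which holds because L > 0.
    refine mul_div_cancel_right₀ _ fun h0 => ?_
    exact PlanarBilliard.liouville_phaseSpace_ne_zero hγ.perimeter_pos
      ((MeasureTheory.measureReal_eq_zero_iff (MeasureTheory.measure_ne_top _ _)).1 h0)
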